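/- Let $k$ be an algebraically closed field of characteristic $0$, let $J$ be a unital Jordan algebra over $k$, and put $\partial_{a,b}c=a(bc)-b(ac)$ for $a,b,c\in J$. Let $\mathfrak G=\mathfrak{sl}_2(J)=(\mathfrak{sl}_2(k)\otimes J)\oplus\{J,J\}$ be the Tits–Allison–Gao Lie algebra, where $\{J,J\}=\bigwedge^2J/\mathrm{Span}\{a\wedge a^2 : a\in J\}$, $\{a,b\}$ is the image of $a\wedge b$, $x(a)=x\otimes a$, $\kappa$ is one half of the Killing form of $\mathfrak{sl}_2(k)$, and $$[x(a),y(b)]=[x,y](ab)+\kappa(x,y)\{a,b\},\quad [\{a,b\},x(c)]=x(\partial_{a,b}c),\quad [\{a,b\},\{c,d\}]=\{\partial_{a,b}c,d\}+\{c,\partial_{a,b}d\}.$$ Let $\{h,e,f\}$ be the standard basis of $\mathfrak{sl}_2(k)$, and put $\mathfrak G_0=h\otimes J\oplus\{J,J\}$ and $\mathfrak G_1=e\otimes J$. For a $\mathfrak G$-module $N$ and $j\in\mathbb Z$ let $N_j=\{v\in N : h(1)v=jv\}$; $N$ is bounded of level $n$ if $N=\bigoplus_{-n\le j\le n}N_j$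 and $N_n\neq 0$. Let $n\ge 0$ be an integer and let $(M,\rho)$ be a nonzero $J$-space of level $n$, that is, $M\ne0$ is a vector space with a linear map $\rho:J\to\mathrm{End}_k(M)$ such that $[\rho(a),\rho(a^2)]=0$ and $[[\rho(a),\rho(b)],\rho(c)]=4\rho(\partial_{a,b}c)$ for all $a,b,c\in J$, and $\rho(1)=n\,\mathrm{id}$. Let $M$ be the $\mathfrak G_0\oplus\mathfrak G_1$-module on which $h(a)$ acts as $\rho(a)$, $\{a,b\}$ acts as $\frac14[\rho(a),\rho(b)]$ and $\mathfrak G_1$ acts as zero, and let $V(M)=\mathcal U(\mathfrak G)\otimes_{\mathcal U(\mathfrak G_0\oplus\mathfrak G_1)}M$ be the generalized Verma module. Then the following conditions are equivalent: (1) $M$ is dominant, that is, there is a bounded $\mathfrak G$-module $N$ of level $n$ such that $M$ is isomorphic to $N_n$ as a $J$-space, where $a\in J$ acts on $N_n$ as $h(a)$; (1$'$) $V(M)$ has a $\mathfrak G$-submodule $X$ such that $V(M)/X$ is bounded of level $n$ and the natural map $M\to V(M)\to V(M)/X$ is injective; (2) $e(1)^{n+1}f(a)^{n+1}m=0$ in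 $V(M)$ for all $a\in J$ and $m\in M$; (3) for all $a\in J$, $$\sum_{\sigma\vdash n+1}\mathrm{sgn}(\sigma)\,|C_\sigma|\,\rho(a^{\sigma_1})\rho(a^{\sigma_2})\cdots\rho(a^{\sigma_m})=0,$$ where $\sigma=(\sigma_1\ge\cdots\ge\sigma_m\geq 1)$ runs over the partitions of $n+1$, $C_\sigma$ is the conjugacy class of permutations in $S_{n+1}$ of cycle type $\sigma$, and $\mathrm{sgn}(\sigma)$ is the sign of these permutations. -/

import Mathlib

open scoped TensorProduct

set_option linter.unusedSectionVars false
set_option linter.unusedSimpArgs false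

noncomputable section

namespace JordanSL2

/-! ## Unital Jordan algebras

A unital Jordan algebra over `k` is a `NonAssocCommRing J` with a `k`-module structure for which the
multiplication is bilinear (`IsScalarTower k J J`, `SMulCommClass k J J`), satisfying the Jordan
identity `IsCommJordan J`. -/

section Jordan

variable {J : Type*} [NonAssocCommRing J]

/-- The powers `a ^ i` in a (power-associative) unital Jordan algebra. -/
def jpow (a : J) : ℕ → J
  | 0 => 1
  | i + 1 => a * jpow a i

variable (k : Type*) [Field k] [Module k J] [IsScalarTower k J J] [SMulCommClass k J J]

/-- The operator `∂_{a,b} = [L_a, L_b]`, that is, `∂_{a,b} c = a (b c) - b (a c)`,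
as a bilinear function of `a` and `b`. -/
def innerDer : J →ₗ[k] J →ₗ[k] Module.End k J :=
  LinearMap.mk₂ k
    (fun a b => LinearMap.mulLeft k a * LinearMap.mulLeft k b
      - LinearMap.mulLeft k b * LinearMap.mulLeft k a)
    (by intro a b c; ext d; simp [add_mul, mul_add]; abel)
    (by intro a b c; ext d; simp [smul_sub, smul_mul_assoc])
    (by intro a b c; ext d; simp [add_mul, mul_add]; abel)
    (by intro a b c; ext d; simp [smul_sub, smul_mul_assoc])

@[simp] lemma innerDer_apply (a b c : J) : innerDer k a b c = a * (b * c) - b * (a * c) := rfl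

variable [IsCommJordan J]

lemma jordan_identity (a c : J) : a * (a * a * c) = a * a * (a * c) := by
  have := IsCommJordan.lmul_comm_rmul_rmul a c
  rw [mul_comm (a * a) c, ← this, mul_comm]

/-- Linearised Jordan identity. -/
lemma jordan_linear [CharZero k] (a b c d : J) :
    (a * b) * (c * d) + (b * c) * (a * d) + (c * a) * (b * d)
      = c * ((a * b) * d) + a * ((b * c) * d) + b * ((c * a) * d) := by
  have key : ∀ a b c : J,
      (2 : k) • ((a * b) * (c * d) + (b * c) * (a * d) + (c * a) * (b * d))
      = (2 : k) • (c * ((a * b) * d) + a * ((b * c) * d) + b * ((c * a) * d)) := by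
    intro a b c
    have h1 := jordan_identity (a + b + c) d
    have h2 := jordan_identity (a + b) d
    have h3 := jordan_identity (b + c) d
    have h4 := jordan_identity (a + c) d
    have h5 := jordan_identity a d
    have h6 := jordan_identity b d
    have h7 := jordan_identity c d
    simp only [mul_add, add_mul] at h1 h2 h3 h4
    simp only [mul_comm b a, mul_comm c a, mul_comm c b] at h1 h2 h3 h4 h5 h6 h7 ⊢
    linear_combination (norm := module) h2 + h3 + h4 - h1 - h5 - h6 - h7
  exact smul_right_injective J (two_ne_zero (α := k)) (key a b c)


/-- `∂_{a,b}` is a derivation of `J`. -/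
lemma innerDer_mul [CharZero k] (a b c d : J) :
    innerDer k a b (c * d) = innerDer k a b c * d + c * innerDer k a b d := by
  have h1 := jordan_linear k c d a b
  have h2 := jordan_linear k c d b a
  simp only [innerDer_apply, sub_mul, mul_sub]
  simp only [mul_comm] at h1 h2 ⊢
  linear_combination (norm := module) h2 - h1

/-! ## The space `{J,J}` -/

/-- The subspace of `J ⊗ J` spanned by all `a ⊗ a` and all `a ⊗ a²`. -/
def relJJ (J : Type*) [NonAssocCommRing J] [Module k J] : Submodule k (J ⊗[k] J) :=
  Submodule.span k
    ({t | ∃ a : J, t = a ⊗ₜ[k] a} ∪ {t | ∃ a : J, t = a ⊗ₜ[k] (a * a)})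

/-- The space `{J,J} = (⋀² J) / Span {a ∧ a²}`, written as the quotient of `J ⊗ J` by the span of
all `a ⊗ a` (which gives `⋀² J`) and all `a ⊗ a²`. -/
abbrev JJ (J : Type*) [NonAssocCommRing J] [Module k J] : Type _ := (J ⊗[k] J) ⧸ relJJ k J

/-- The element `{a,b}`, the image of `a ∧ b` in `{J,J}`, as a bilinear function of `a`, `b`. -/
def brace : J →ₗ[k] J →ₗ[k] JJ k J :=
  (TensorProduct.mk k J J).compr₂ (relJJ k J).mkQ

lemma brace_self (a : J) : brace k a a = 0 :=
  (Submodule.Quotient.mk_eq_zero _).2 (Submodule.subset_span (Or.inl ⟨a, rfl⟩))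

lemma brace_sq (a : J) : brace k a (a * a) = 0 :=
  (Submodule.Quotient.mk_eq_zero _).2 (Submodule.subset_span (Or.inr ⟨a, rfl⟩))

lemma brace_skew (a b : J) : brace k b a = - brace k a b := by
  have h := brace_self k (a + b)
  simp only [map_add, LinearMap.add_apply, brace_self] at h
  linear_combination (norm := module) h

lemma brace_cyc [CharZero k] (a b c : J) :
    brace k (a * b) c + brace k (b * c) a + brace k (c * a) b = 0 := by
  have h1 := brace_sq k (a + b + c)
  have h2 := brace_sq k (a + b)
  have h3 := brace_sq k (b + c)
  have h4 := brace_sq k (a + c)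
  have h5 := brace_sq k a
  have h6 := brace_sq k b
  have h7 := brace_sq k c
  simp only [mul_add, add_mul, map_add, LinearMap.add_apply] at h1 h2 h3 h4
  simp only [mul_comm b a, mul_comm c a, mul_comm c b] at h1 h2 h3 h4 h5 h6 h7 ⊢
  rw [brace_skew k c (a * b), brace_skew k a (b * c), brace_skew k b (a * c)]
  apply smul_right_injective _ (two_ne_zero (α := k))
  linear_combination (norm := module) h2 + h3 + h4 - h1 - h5 - h6 - h7

/-- A linear map out of `{J,J}` is given by a bilinear map `B` with `B a a = 0 = B a a²`. -/
def JJ.lift {N : Type*} [AddCommGroup N] [Module k N] (B : J →ₗ[k] J →ₗ[k] N)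
    (h₁ : ∀ a, B a a = 0) (h₂ : ∀ a, B a (a * a) = 0) : JJ k J →ₗ[k] N :=
  (relJJ k J).liftQ (TensorProduct.lift B) (by
    refine Submodule.span_le.2 ?_
    rintro _ (⟨a, rfl⟩ | ⟨a, rfl⟩)
    · simpa using h₁ a
    · simpa using h₂ a)

@[simp] lemma JJ.lift_brace {N : Type*} [AddCommGroup N] [Module k N] (B : J →ₗ[k] J →ₗ[k] N)
    (h₁ : ∀ a, B a a = 0) (h₂ : ∀ a, B a (a * a) = 0) (a b : J) :
    JJ.lift k B h₁ h₂ (brace k a b) = B a b := by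
  exact TensorProduct.lift.tmul a b

variable {k} in
lemma JJ.induction {P : JJ k J → Prop} (z : JJ k J) (zero : P 0)
    (add : ∀ x y, P x → P y → P (x + y)) (brace : ∀ a b, P (brace k a b)) : P z := by
  obtain ⟨t, rfl⟩ := (relJJ k J).mkQ_surjective z
  induction t using TensorProduct.induction_on with
  | zero => simpa using zero
  | tmul a b => exact brace a b
  | add x y hx hy => rw [map_add]; exact add _ _ hx hy

/-- The action of `{J,J}` on `J`, with `{a,b}` acting as `∂_{a,b}`. -/
def der : JJ k J →ₗ[k] Module.End k J :=
  JJ.lift k (innerDer k)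
    (by intro a; ext c; simp)
    (by intro a; ext c; simp [jordan_identity])

@[simp] lemma der_brace (a b c : J) : der k (brace k a b) c = a * (b * c) - b * (a * c) := by
  simp [der]

lemma der_mul [CharZero k] (z : JJ k J) (c d : J) :
    der k z (c * d) = der k z c * d + c * der k z d := by
  induction z using JJ.induction with
  | zero => simp
  | add x y hx hy => simp only [map_add, LinearMap.add_apply, hx, hy, add_mul, mul_add]; abel
  | brace a b => simpa [der] using innerDer_mul k a b c d

/-- The bilinear map `(c, d) ↦ (z ↦ {z c, d} + {c, z d})`. -/
def actAux : J →ₗ[k] J →ₗ[k] (JJ k J →ₗ[k] JJ k J) :=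
  LinearMap.mk₂ k
    (fun c d => (brace k).flip d ∘ₗ (der k).flip c + brace k c ∘ₗ (der k).flip d)
    (by intro a b c; refine LinearMap.ext fun z => ?_; simp; abel)
    (by intro a b c; refine LinearMap.ext fun z => ?_; simp)
    (by intro a b c; refine LinearMap.ext fun z => ?_; simp; abel)
    (by intro a b c; refine LinearMap.ext fun z => ?_; simp)

/-- The action of `{J,J}` on itself: `z` sends `{c,d}` to `{z c, d} + {c, z d}`. -/
def act [CharZero k] : JJ k J →ₗ[k] JJ k J →ₗ[k] JJ k J :=
  (JJ.lift k (actAux k)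
    (by
      intro c; refine LinearMap.ext fun z => ?_
      simp [actAux, brace_skew k c])
    (by
      intro c; refine LinearMap.ext fun z => ?_
      have h := brace_cyc k c c (der k z c)
      have s := brace_skew k (der k z c) (c * c)
      have t := brace_skew k c (c * der k z c)
      simp only [actAux, LinearMap.mk₂_apply, LinearMap.add_apply, LinearMap.comp_apply,
        LinearMap.flip_apply, der_mul, map_add, LinearMap.zero_apply]
      simp only [mul_comm _ c] at h s t ⊢
      linear_combination (norm := module) s + t + t - h)).flip

@[simp] lemma act_brace [CharZero k] (z : JJ k J) (c d : J) :
    act k z (brace k c d) = brace k (der k z c) d + brace k c (der k z d) := by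
  simp [act, actAux]

lemma act_skew [CharZero k] (z w : JJ k J) : act k z w = - act k w z := by
  induction z using JJ.induction with
  | zero => simp
  | add x y hx hy => simp only [map_add, LinearMap.add_apply, hx, hy]; abel
  | brace a b =>
    induction w using JJ.induction with
    | zero => simp
    | add x y hx hy => simp only [map_add, LinearMap.add_apply, hx, hy]; abel
    | brace c d =>
      have h1 := brace_cyc k a (b * c) d
      have h2 := brace_cyc k b (a * c) d
      have h3 := brace_cyc k a (b * d) c
      have h4 := brace_cyc k b (a * d) c
      have s1 := brace_skew k (a * c) (b * d)
      have s2 := brace_skew k (a * d) (b * c)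
      have s3 := brace_skew k c (a * (b * d))
      have s4 := brace_skew k c (b * (a * d))
      have s5 := brace_skew k a (c * (d * b))
      have s6 := brace_skew k a (d * (c * b))
      simp only [act_brace, der_brace, map_sub, LinearMap.sub_apply]
      simp only [mul_comm] at h1 h2 h3 h4 s1 s2 s3 s4 s5 s6 ⊢
      linear_combination (norm := module) h1 - h2 - h3 + h4 + s3 - s4 + s5 - s6 + s1 - s2

lemma act_self [CharZero k] (z : JJ k J) : act k z z = 0 := by
  have h := act_skew k z z
  apply smul_right_injective _ (two_ne_zero (α := k))
  linear_combination (norm := module) h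

lemma der_act [CharZero k] (z w : JJ k J) (c : J) :
    der k (act k z w) c = der k z (der k w c) - der k w (der k z c) := by
  induction w using JJ.induction with
  | zero => simp
  | add x y hx hy => simp only [map_add, LinearMap.add_apply, hx, hy]; abel
  | brace a b =>
    simp only [act_brace, map_add, LinearMap.add_apply, der_brace, map_sub, der_mul]
    simp only [mul_add]
    abel

lemma act_act [CharZero k] (z w u : JJ k J) :
    act k z (act k w u) = act k (act k z w) u + act k w (act k z u) := by
  induction u using JJ.induction with
  | zero => simp
  | add x y hx hy => simp only [map_add, hx, hy]; abel
  | brace a b =>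
    simp only [act_brace, map_add, der_act, map_sub, LinearMap.sub_apply]
    abel


end Jordan

/-! ## The Lie algebra `sl₂(J)` -/

section LieAlg

/-- The vector space `sl₂(J) = (sl₂(k) ⊗ J) ⊕ {J,J}`. With respect to the standard basis `e, h, f` of
`sl₂(k)`, the element `⟨a, b, c, z⟩` is `e(a) + h(b) + f(c) + z`, where `x(a) = x ⊗ a`. -/
@[ext]
structure SL2J (k J : Type*) [Field k] [NonAssocCommRing J] [Module k J] where
  /-- The coefficient of `e`. -/
  e : J
  /-- The coefficient of `h`. -/
  h : J
  /-- The coefficient of `f`. -/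
  f : J
  /-- The component in `{J,J}`. -/
  z : JJ k J

namespace SL2J

variable (k J : Type*) [Field k] [NonAssocCommRing J] [Module k J]

/-- The identification with `J × J × J × {J,J}`, used to transfer the vector space structure. -/
def equivProd : SL2J k J ≃ J × J × J × JJ k J where
  toFun x := (x.e, x.h, x.f, x.z)
  invFun p := ⟨p.1, p.2.1, p.2.2.1, p.2.2.2⟩
  left_inv _ := rfl
  right_inv _ := rfl

instance : AddCommGroup (SL2J k J) := (equivProd k J).addCommGroup

instance : Module k (SL2J k J) := (equivProd k J).module k

variable {k J}

@[simp] lemma add_e (x y : SL2J k J) : (x + y).e = x.e + y.e := rfl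
@[simp] lemma add_h (x y : SL2J k J) : (x + y).h = x.h + y.h := rfl
@[simp] lemma add_f (x y : SL2J k J) : (x + y).f = x.f + y.f := rfl
@[simp] lemma add_z (x y : SL2J k J) : (x + y).z = x.z + y.z := rfl
@[simp] lemma zero_e : (0 : SL2J k J).e = 0 := rfl
@[simp] lemma zero_h : (0 : SL2J k J).h = 0 := rfl
@[simp] lemma zero_f : (0 : SL2J k J).f = 0 := rfl
@[simp] lemma zero_z : (0 : SL2J k J).z = 0 := rfl
@[simp] lemma smul_e (r : k) (x : SL2J k J) : (r • x).e = r • x.e := rfl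
@[simp] lemma smul_h (r : k) (x : SL2J k J) : (r • x).h = r • x.h := rfl
@[simp] lemma smul_f (r : k) (x : SL2J k J) : (r • x).f = r • x.f := rfl
@[simp] lemma smul_z (r : k) (x : SL2J k J) : (r • x).z = r • x.z := rfl

variable [IsScalarTower k J J] [SMulCommClass k J J] [IsCommJordan J] [CharZero k]

/-- The bracket of `sl₂(J)`. It is the bilinear skew-symmetric bracket determined by
* `[x(a), y(b)] = [x,y](ab) + κ(x,y) {a,b}`,
* `[{a,b}, x(c)] = x(∂_{a,b} c)`,
* `[{a,b}, {c,d}] = {∂_{a,b} c, d} + {c, ∂_{a,b} d}`,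

where `[h,e] = 2e`, `[h,f] = -2f`, `[e,f] = h`, and `κ` is one half of the Killing form of `sl₂(k)`,
that is, `κ(h,h) = 4`, `κ(e,f) = κ(f,e) = 2`, and `κ` vanishes on the other pairs of basis
vectors. -/
instance : Bracket (SL2J k J) (SL2J k J) where
  bracket x y :=
    { e := (2 : k) • (x.h * y.e - x.e * y.h) + der k x.z y.e - der k y.z x.e
      h := x.e * y.f - x.f * y.e + der k x.z y.h - der k y.z x.h
      f := (2 : k) • (x.f * y.h - x.h * y.f) + der k x.z y.f - der k y.z x.f
      z := (4 : k) • brace k x.h y.h + (2 : k) • (brace k x.e y.f + brace k x.f y.e)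
        + act k x.z y.z }

lemma lie_e (x y : SL2J k J) : ⁅x, y⁆.e =
    (2 : k) • (x.h * y.e - x.e * y.h) + der k x.z y.e - der k y.z x.e := rfl
lemma lie_h (x y : SL2J k J) : ⁅x, y⁆.h =
    x.e * y.f - x.f * y.e + der k x.z y.h - der k y.z x.h := rfl
lemma lie_f (x y : SL2J k J) : ⁅x, y⁆.f =
    (2 : k) • (x.f * y.h - x.h * y.f) + der k x.z y.f - der k y.z x.f := rfl
lemma lie_z (x y : SL2J k J) : ⁅x, y⁆.z =
    (4 : k) • brace k x.h y.h + (2 : k) • (brace k x.e y.f + brace k x.f y.e)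
      + act k x.z y.z := rfl

instance : LieRing (SL2J k J) where
  add_lie x y z := by
    ext <;> simp only [lie_e, lie_h, lie_f, lie_z, add_e, add_h, add_f, add_z, add_mul, mul_add,
      map_add, LinearMap.add_apply] <;> module
  lie_add x y z := by
    ext <;> simp only [lie_e, lie_h, lie_f, lie_z, add_e, add_h, add_f, add_z, add_mul, mul_add,
      map_add, LinearMap.add_apply] <;> module
  lie_self x := by
    ext
    · simp [lie_e, mul_comm]
    · simp [lie_h, mul_comm]
    · simp [lie_f, mul_comm]
    · simp [lie_z, brace_self, act_self, brace_skew k x.e x.f]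
  leibniz_lie x y z := by
    ext
    · simp only [lie_e, lie_h, lie_f, lie_z, add_e, add_h, add_f, map_add, map_sub, map_smul,
        LinearMap.add_apply, LinearMap.smul_apply, der_act, der_brace, der_mul, mul_add, add_mul,
        mul_sub, sub_mul, smul_mul_assoc, mul_smul_comm, smul_add, smul_sub]
      simp only [mul_comm]
      module
    · simp only [lie_e, lie_h, lie_f, lie_z, add_e, add_h, add_f, map_add, map_sub, map_smul,
        LinearMap.add_apply, LinearMap.smul_apply, der_act, der_brace, der_mul, mul_add, add_mul,
        mul_sub, sub_mul, smul_mul_assoc, mul_smul_comm, smul_add, smul_sub]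
      simp only [mul_comm]
      module
    · simp only [lie_e, lie_h, lie_f, lie_z, add_e, add_h, add_f, map_add, map_sub, map_smul,
        LinearMap.add_apply, LinearMap.smul_apply, der_act, der_brace, der_mul, mul_add, add_mul,
        mul_sub, sub_mul, smul_mul_assoc, mul_smul_comm, smul_add, smul_sub]
      simp only [mul_comm]
      module
    · have hm : ∀ a b c : J, brace k (a * b) c = - brace k c (a * b) := fun a b c =>
        brace_skew k c (a * b)
      have hd : ∀ (w : JJ k J) (a c : J), brace k (der k w a) c = - brace k c (der k w a) :=
        fun w a c => brace_skew k c (der k w a)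
      have ha : ∀ (w : JJ k J) (a b : J), act k (brace k a b) w
          = - (brace k (der k w a) b + brace k a (der k w b)) := fun w a b => by
        rw [act_skew, act_brace]
      have h1 := brace_cyc k x.h y.e z.f
      have h2 := brace_cyc k x.h y.f z.e
      have h3 := brace_cyc k x.e y.h z.f
      have h4 := brace_cyc k x.f y.h z.e
      have h5 := brace_cyc k x.e y.f z.h
      have h6 := brace_cyc k x.f y.e z.h
      simp only [lie_e, lie_h, lie_f, lie_z, add_z, map_add, map_sub, map_smul,
        LinearMap.add_apply, LinearMap.sub_apply, LinearMap.smul_apply, act_act k x.z y.z z.z,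
        act_brace, ha, smul_add, smul_sub]
      simp only [hm, hd] at h1 h2 h3 h4 h5 h6 ⊢
      simp only [mul_comm] at h1 h2 h3 h4 h5 h6 ⊢
      linear_combination (norm := skip) (-4 : k) • h1 + (4 : k) • h2
        + (4 : k) • h3 - (4 : k) • h4 - (4 : k) • h5 + (4 : k) • h6
      module

instance : LieAlgebra k (SL2J k J) where
  lie_smul r x y := by
    ext <;> simp only [lie_e, lie_h, lie_f, lie_z, smul_e, smul_h, smul_f, smul_z, map_smul,
      mul_smul_comm, smul_mul_assoc, LinearMap.smul_apply] <;> module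

variable (k)

/-- The element `e(a) = e ⊗ a`. -/
def E (a : J) : SL2J k J := ⟨a, 0, 0, 0⟩

/-- The element `h(a) = h ⊗ a`. -/
def H (a : J) : SL2J k J := ⟨0, a, 0, 0⟩

/-- The element `f(a) = f ⊗ a`. -/
def F (a : J) : SL2J k J := ⟨0, 0, a, 0⟩

variable (J) in
/-- The subalgebra `𝔊₀ ⊕ 𝔊₁ = (h ⊗ J ⊕ {J,J}) ⊕ (e ⊗ J)` of `𝔊 = sl₂(J)`. -/
def parabolic : LieSubalgebra k (SL2J k J) where
  carrier := {x | x.f = 0}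
  add_mem' {x y} hx hy := by simp_all
  zero_mem' := rfl
  smul_mem' r x hx := by simp_all
  lie_mem' {x y} hx hy := by simp_all [lie_f]

end SL2J

end LieAlg

/-! ## Bounded modules -/

section Bounded

variable (k J : Type*) [Field k] [CharZero k] [NonAssocCommRing J] [Module k J]
  [IsScalarTower k J J] [SMulCommClass k J J] [IsCommJordan J]
  (N : Type*) [AddCommGroup N] [Module k N] [LieRingModule (SL2J k J) N] [LieModule k (SL2J k J) N]

/-- The weight space `N_j = {v | h(1) v = j v}`. -/
def weightSpace (j : ℤ) : Submodule k N where
  carrier := {v | ⁅SL2J.H k (1 : J), v⁆ = (j : k) • v}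
  add_mem' {v w} hv hw := by
    have hv : ⁅SL2J.H k (1 : J), v⁆ = (j : k) • v := hv
    have hw : ⁅SL2J.H k (1 : J), w⁆ = (j : k) • w := hw
    show ⁅SL2J.H k (1 : J), v + w⁆ = (j : k) • (v + w)
    rw [lie_add, hv, hw, smul_add]
  zero_mem' := by
    show ⁅SL2J.H k (1 : J), (0 : N)⁆ = (j : k) • (0 : N)
    simp
  smul_mem' r v hv := by
    have hv : ⁅SL2J.H k (1 : J), v⁆ = (j : k) • v := hv
    show ⁅SL2J.H k (1 : J), r • v⁆ = (j : k) • (r • v)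
    rw [lie_smul, hv, smul_comm]

/-- `N` is a bounded weight module of level `n`: `N = ⨁_{-n ≤ j ≤ n} N_j` and `N_n ≠ 0`. -/
def IsBoundedOfLevel (n : ℕ) : Prop :=
  DirectSum.IsInternal (fun j : Set.Icc (-(n : ℤ)) (n : ℤ) => weightSpace k J N j) ∧
    weightSpace k J N n ≠ ⊥

end Bounded

/-! ## `J`-spaces and generalized Verma modules -/

/-- A `J`-space structure on the vector space `M`. -/
structure JSpace (k J M : Type*) [Field k] [NonAssocCommRing J] [Module k J]
    [IsScalarTower k J J] [SMulCommClass k J J] [AddCommGroup M] [Module k M] where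
  /-- The action of `J`. -/
  ρ : J →ₗ[k] Module.End k M
  /-- `[ρ(a), ρ(a²)] = 0`. -/
  lie_sq : ∀ a, ρ a * ρ (a * a) - ρ (a * a) * ρ a = 0
  /-- `[[ρ(a), ρ(b)], ρ(c)] = 4 ρ(∂_{a,b} c)`. -/
  lie_lie : ∀ a b c, (ρ a * ρ b - ρ b * ρ a) * ρ c - ρ c * (ρ a * ρ b - ρ b * ρ a)
    = (4 : k) • ρ (innerDer k a b c)

namespace JSpace

variable {k J M : Type*} [Field k] [NonAssocCommRing J] [Module k J]
  [IsScalarTower k J J] [SMulCommClass k J J] [AddCommGroup M] [Module k M]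

/-- The `J`-space has level `n`: `ρ(1) = n id`. -/
def IsOfLevel (V : JSpace k J M) (n : ℕ) : Prop := V.ρ 1 = (n : k) • (1 : Module.End k M)

variable [CharZero k] [IsCommJordan J] (V : JSpace k J M)

/-- The action of `{J,J}` on a `J`-space: `{a,b}` acts as `(1/4) [ρ(a), ρ(b)]`, as is forced by
`[h(a), h(b)] = 4 {a,b}`. -/
def braceAction : JJ k J →ₗ[k] Module.End k M :=
  JJ.lift k
    (LinearMap.mk₂ k (fun a b => (4 : k)⁻¹ • (V.ρ a * V.ρ b - V.ρ b * V.ρ a))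
      (by intro a b c; simp only [map_add, add_mul, mul_add]; module)
      (by intro r a b; simp only [map_smul, smul_mul_assoc, mul_smul_comm]; module)
      (by intro a b c; simp only [map_add, add_mul, mul_add]; module)
      (by intro r a b; simp only [map_smul, smul_mul_assoc, mul_smul_comm]; module))
    (by intro a; simp)
    (by intro a; simp [V.lie_sq a])

@[simp] lemma braceAction_brace (a b : J) :
    V.braceAction (brace k a b) = (4 : k)⁻¹ • (V.ρ a * V.ρ b - V.ρ b * V.ρ a) := by
  simp [braceAction]

/-- The action of `𝔊₀ ⊕ 𝔊₁` on a `J`-space: `h(a)` acts as `ρ(a)`, `{J,J}` as above, and `𝔊₁` acts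
as zero. -/
def parabolicAction : SL2J.parabolic k J →ₗ[k] Module.End k M where
  toFun x := V.ρ x.1.h + V.braceAction x.1.z
  map_add' x y := by simp; abel
  map_smul' r x := by simp

lemma braceAction_lie_ρ (z : JJ k J) (c : J) :
    V.braceAction z * V.ρ c - V.ρ c * V.braceAction z = V.ρ (der k z c) := by
  induction z using JJ.induction with
  | zero => simp
  | add x y hx hy =>
    simp only [map_add, LinearMap.add_apply, ← hx, ← hy, add_mul, mul_add]; abel
  | brace a b =>
    have h4 : (4 : k) ≠ 0 := by norm_num
    have h := V.lie_lie a b c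
    rw [braceAction_brace, smul_mul_assoc, mul_smul_comm, ← smul_sub, h, smul_smul,
      inv_mul_cancel₀ h4, one_smul, der_brace, innerDer_apply]

lemma braceAction_lie (z w : JJ k J) :
    V.braceAction z * V.braceAction w - V.braceAction w * V.braceAction z
      = V.braceAction (act k z w) := by
  induction w using JJ.induction with
  | zero => simp
  | add x y hx hy =>
    simp only [map_add, ← hx, ← hy, add_mul, mul_add]; abel
  | brace a b =>
    simp only [act_brace, map_add, braceAction_brace, ← V.braceAction_lie_ρ, mul_smul_comm,
      smul_mul_assoc, mul_sub, sub_mul, mul_assoc]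
    module

/-- `M` is a module over the Lie algebra `𝔊₀ ⊕ 𝔊₁`. -/
lemma parabolicAction_lie (x y : SL2J.parabolic k J) :
    V.parabolicAction ⁅x, y⁆ = V.parabolicAction x * V.parabolicAction y
      - V.parabolicAction y * V.parabolicAction x := by
  obtain ⟨x, hx⟩ := x
  obtain ⟨y, hy⟩ := y
  have hx : x.f = 0 := hx
  have hy : y.f = 0 := hy
  have h1 := V.braceAction_lie_ρ x.z y.h
  have h2 := V.braceAction_lie_ρ y.z x.h
  have h3 := V.braceAction_lie x.z y.z
  have h4 : (4 : k) • V.braceAction (brace k x.h y.h) = V.ρ x.h * V.ρ y.h - V.ρ y.h * V.ρ x.h := by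
    rw [braceAction_brace, smul_smul, mul_inv_cancel₀ (by norm_num), one_smul]
  simp only [parabolicAction, LinearMap.coe_mk, AddHom.coe_mk, LieSubalgebra.coe_bracket,
    SL2J.lie_h, SL2J.lie_z, hx, hy, map_add, map_sub, map_smul, mul_zero, zero_mul, map_zero,
    LinearMap.zero_apply, smul_zero, sub_zero, add_zero, ← h1, ← h2, ← h3, h4, add_mul, mul_add]
  abel

/-- The span of all `u x ⊗ m - u ⊗ x m` with `u ∈ U(𝔊)`, `x ∈ 𝔊₀ ⊕ 𝔊₁`, `m ∈ M`; that is, the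
`U(𝔊)`-submodule of `U(𝔊) ⊗ M` generated by all `x ⊗ m - 1 ⊗ x m`. -/
def vermaRel : Submodule (UniversalEnvelopingAlgebra k (SL2J k J))
    (UniversalEnvelopingAlgebra k (SL2J k J) ⊗[k] M) :=
  Submodule.span _ {t | ∃ (x : SL2J.parabolic k J) (m : M),
    t = UniversalEnvelopingAlgebra.ι k (x : SL2J k J) ⊗ₜ[k] m - 1 ⊗ₜ[k] V.parabolicAction x m}

/-- The generalized Verma module `V(M) = U(𝔊) ⊗_{U(𝔊₀ ⊕ 𝔊₁)} M`. -/
abbrev Verma : Type _ := (UniversalEnvelopingAlgebra k (SL2J k J) ⊗[k] M) ⧸ V.vermaRel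

/-- The natural map `M → V(M)`, `m ↦ 1 ⊗ m`. -/
def toVerma : M →ₗ[k] V.Verma :=
  (V.vermaRel.mkQ.restrictScalars k) ∘ₗ
    TensorProduct.mk k (UniversalEnvelopingAlgebra k (SL2J k J)) M 1

section

attribute [local instance 100] LieRing.ofAssociativeRing

lemma ι_lie (x y : SL2J k J) : UniversalEnvelopingAlgebra.ι k ⁅x, y⁆ =
    UniversalEnvelopingAlgebra.ι k x * UniversalEnvelopingAlgebra.ι k y
      - UniversalEnvelopingAlgebra.ι k y * UniversalEnvelopingAlgebra.ι k x := by
  rw [LieHom.map_lie, LieRing.of_associative_ring_bracket]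

end

/-- `V(M)` is a `𝔊`-module through left multiplication by `𝔊 ⊆ U(𝔊)`. -/
instance : LieRingModule (SL2J k J) V.Verma where
  bracket x v := UniversalEnvelopingAlgebra.ι k x • v
  add_lie x y v := by
    show UniversalEnvelopingAlgebra.ι k (x + y) • v = _ • v + _ • v
    rw [map_add, add_smul]
  lie_add x v w := smul_add _ v w
  leibniz_lie x y v := by
    show _ • _ • v = UniversalEnvelopingAlgebra.ι k ⁅x, y⁆ • v + _ • _ • v
    rw [ι_lie, sub_smul, mul_smul, mul_smul,
      sub_add_cancel]

instance : LieModule k (SL2J k J) V.Verma where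
  smul_lie r x v := by
    show UniversalEnvelopingAlgebra.ι k (r • x) • v = r • _ • v
    rw [map_smul, smul_assoc]
  lie_smul r x v := by
    show UniversalEnvelopingAlgebra.ι k x • r • v = r • _ • v
    rw [smul_comm]

/-- `V(M)` has a bounded `M`-quotient of level `n`: there is a submodule `X` such that `V(M)/X` is
bounded of level `n` and the natural map `M → V(M) → V(M)/X` is injective. -/
def HasBoundedQuotient (n : ℕ) : Prop :=
  ∃ X : LieSubmodule k (SL2J k J) V.Verma,
    IsBoundedOfLevel k J (V.Verma ⧸ X) n ∧
      Function.Injective (fun m : M => LieSubmodule.Quotient.mk' X (V.toVerma m))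

/-- `ρ_σ(a) = ρ(a^{σ₁}) ρ(a^{σ₂}) ⋯ ρ(a^{σ_m})` for the partition `σ = (σ₁ ≥ σ₂ ≥ ⋯ ≥ σ_m)`. -/
def ρPartition (V : JSpace k J M) {N : ℕ} (σ : N.Partition) (a : J) : Module.End k M :=
  ((σ.parts.sort (· ≥ ·)).map fun i => V.ρ (jpow a i)).prod

end JSpace

section Dominant

universe u v w

/-- A `J`-space `M` is dominant of level `n` if it is (isomorphic to) the top weight space `N_n` of
some bounded `sl₂(J)`-module `N` of level `n`, where `a ∈ J` acts on `N_n` as `h(a)`. -/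
def JSpace.IsDominant {k : Type u} {J : Type v} {M : Type w} [Field k] [CharZero k]
    [NonAssocCommRing J] [Module k J] [IsScalarTower k J J] [SMulCommClass k J J] [IsCommJordan J]
    [AddCommGroup M] [Module k M] (V : JSpace k J M) (n : ℕ) : Prop :=
  ∃ (N : Type (max u v w)) (_ : AddCommGroup N) (_ : Module k N)
    (_ : LieRingModule (SL2J k J) N) (_ : LieModule k (SL2J k J) N),
    IsBoundedOfLevel k J N n ∧
      ∃ φ : M ≃ₗ[k] weightSpace k J N n,
        ∀ (a : J) (m : M), (φ (V.ρ a m) : N) = ⁅SL2J.H k a, (φ m : N)⁆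

end Dominant

/-! ## Conjugacy classes of the symmetric group -/

/-- The conjugacy class `C_σ` of permutations in `S_N` with cycle structure `σ`. -/
def conjClass {N : ℕ} (σ : N.Partition) : Finset (Equiv.Perm (Fin N)) :=
  {g | g.partition.parts = σ.parts}

/-- The sign of the permutations with cycle structure `σ`: a cycle of length `i` contributes
`-(-1)^i`. -/
def signPartition {N : ℕ} (σ : N.Partition) : ℤ := (σ.parts.map fun i => -(-1 : ℤ) ^ i).prod

lemma sign_of_mem_conjClass {N : ℕ} (σ : N.Partition) (g : Equiv.Perm (Fin N))
    (hg : g ∈ conjClass σ) : (Equiv.Perm.sign g : ℤ) = signPartition σ := by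
  have hg : g.partition.parts = σ.parts := by simpa [conjClass] using hg
  rw [signPartition, ← hg, Equiv.Perm.parts_partition, Equiv.Perm.sign_of_cycleType']
  induction g.cycleType using Multiset.induction_on with
  | empty => simp
  | cons i s ih => simpa using ih

end JordanSL2
end

/-! Grade $V(M)$ by the number $r$ of factors from $\mathfrak G_{-1}$; degree $r$ has weight $n-2r$,
so the degrees $r>n$ are those that must die in a quotient of level $n$.

(1) and (1$'$) agree because $N_n$ is killed by all $e(a)$ (as $N_{n+2}=0$), so $M\cong N_n$ extends
to a homomorphism $V(M)\to N$ that is injective on $M$; conversely the top weight space of $V(M)/X$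
is the image of $M$.

For (2) and (3), the vector $e(1)^{n+1}f(a)^{n+1}m$ is computed exactly. The braces $\{a^i,a^j\}$
vanish (`brace_jpow_jpow`), so commuting the operators gives a closed recursion (`pow_op_E_op_F`) in
the commuting operators $\rho(a^i)$. Its solution is `newtonSum`, and Newton's identities
(`esymmSum_newton`, `newtonSum_eq`) recognise it as $(n+1)!$ times the elementary symmetric function
$e_{n+1}$ with power sums $\rho(a^i)$, which is the signed sum over conjugacy classes. Since $M$
embeds in $V(M)$, (2) is equivalent to (3).

(1$'$) implies (3): $f(a)^{n+1}m$ has weight $-n-2$, hence lies in $X$, and $e(1)^{n+1}$ brings it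
back to $M\cap X=0$.

(2) implies (1$'$): polarizing in $a$ shows that $e(1)^{n+1}$ kills all of degree $n+1$; commutators
with $h(b)$ then replace each $e(1)$ by an arbitrary $e(b)$ (`raising_pow_apply_eq_zero`). Take for
$X$ the kernel of the canonical map from $V(M)$ to the module coinduced from $\mathfrak
G_{-1}\oplus\mathfrak G_0$. An element of the coinduced module is determined by the values at $1$ of
its images under products of the $e(b)$, so degree $n+1$, and with it every higher degree, maps to
zero, while $M$ maps injectively. The same map proves that $M\to V(M)$ is injective, so the
Poincaré–Birkhoff–Witt theorem is never needed. -/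

open scoped TensorProduct

set_option linter.unusedSectionVars false

noncomputable section

namespace JordanSL2

/-! ### Brackets of the elements $e(a)$, $h(a)$, $f(a)$. -/

namespace SL2J

variable {k J : Type*} [Field k] [CharZero k] [NonAssocCommRing J] [Module k J]
  [IsScalarTower k J J] [SMulCommClass k J J] [IsCommJordan J]

/-- The inclusion of `{J,J}` into `sl₂(J)`. -/
def Z (z : JJ k J) : SL2J k J := ⟨0, 0, 0, z⟩

lemma eq_add (x : SL2J k J) : x = E k x.e + H k x.h + F k x.f + Z x.z := by
  ext <;> simp [E, H, F, Z]

lemma E_add (a b : J) : E k (a + b) = E k a + E k b := by ext <;> simp [E]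
lemma E_smul (r : k) (a : J) : E k (r • a) = r • E k a := by ext <;> simp [E]
lemma F_add (a b : J) : F k (a + b) = F k a + F k b := by ext <;> simp [F]
lemma F_smul (r : k) (a : J) : F k (r • a) = r • F k a := by ext <;> simp [F]

lemma lie_E_F (a b : J) : ⁅E k a, F k b⁆ = H k (a * b) + (2 : k) • Z (brace k a b) := by
  ext <;> simp [lie_e, lie_h, lie_f, lie_z, E, F, H, Z]

lemma lie_E_E (a b : J) : ⁅E k a, E k b⁆ = 0 := by
  ext <;> simp [lie_e, lie_h, lie_f, lie_z, E, F, H, Z]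

lemma lie_F_F (a b : J) : ⁅F k a, F k b⁆ = 0 := by
  ext <;> simp [lie_e, lie_h, lie_f, lie_z, E, F, H, Z]

lemma lie_H_E (a b : J) : ⁅H k a, E k b⁆ = (2 : k) • E k (a * b) := by
  ext <;> simp [lie_e, lie_h, lie_f, lie_z, E, F, H, Z]

lemma lie_H_F (a b : J) : ⁅H k a, F k b⁆ = (-2 : k) • F k (a * b) := by
  ext <;> simp only [lie_e, lie_h, lie_f, lie_z, F, H, smul_e, smul_h, smul_f, smul_z] <;>
    simp [mul_comm]

lemma lie_H_H (a b : J) : ⁅H k a, H k b⁆ = (4 : k) • Z (brace k a b) := by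
  ext <;> simp [lie_e, lie_h, lie_f, lie_z, E, F, H, Z]

end SL2J

/-! ### The coinduced module, realised on symmetric multilinear functions. -/

namespace JSpace

open SL2J

variable {k J M : Type*} [Field k] [NonAssocCommRing J] [Module k J]
  [IsScalarTower k J J] [SMulCommClass k J J] [AddCommGroup M] [Module k M]
  [CharZero k] [IsCommJordan J] (V : JSpace k J M)

/-- The linear extension to `sl₂(J)` of the action of `𝔊₀` on a `J`-space, zero on `𝔊₁` and
`𝔊₋₁`. -/
def leviAction : SL2J k J →ₗ[k] Module.End k M where
  toFun x := V.ρ x.h + V.braceAction x.z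
  map_add' x y := by simp; abel
  map_smul' r x := by simp

lemma leviAction_apply (x : SL2J k J) : V.leviAction x = V.ρ x.h + V.braceAction x.z := rfl

/-- `leviAction` is not a representation of $\mathfrak G$: brackets of $\mathfrak G_1$ with
$\mathfrak G_{-1}$ land in $\mathfrak G_0$. The two correction terms record this defect in the shape
that `coact` produces on one-element lists. -/
lemma leviAction_lie (x y : SL2J k J) :
    V.leviAction ⁅x, y⁆ = V.leviAction x * V.leviAction y - V.leviAction y * V.leviAction x
      + V.leviAction ⁅E k x.e, y⁆ - V.leviAction ⁅E k y.e, x⁆ := by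
  have h1 := V.braceAction_lie_ρ x.z y.h
  have h2 := V.braceAction_lie_ρ y.z x.h
  have h3 := V.braceAction_lie x.z y.z
  have h4 : (4 : k) • V.braceAction (brace k x.h y.h) = V.ρ x.h * V.ρ y.h - V.ρ y.h * V.ρ x.h := by
    rw [braceAction_brace, smul_smul, mul_inv_cancel₀ (by norm_num), one_smul]
  simp only [leviAction_apply, SL2J.lie_h, SL2J.lie_z, map_add, map_sub, map_smul, E, mul_zero,
    zero_mul, map_zero, LinearMap.zero_apply, smul_zero, sub_zero, add_zero, zero_add, ← h1, ← h2,
    ← h3, h4, add_mul, mul_add, brace_skew k y.e x.f, mul_comm y.e x.f, smul_add, map_neg, smul_neg]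
  abel

/-- The action of `sl₂(J)` on the functions `List J → M`, where `φ [x₁, …, xᵣ]` stands for the value
at `1` of `e(xᵣ) ⋯ e(x₁) φ` in the module coinduced from `𝔊₋₁ ⊕ 𝔊₀` to `𝔊`. -/
def coact : List J → SL2J k J → (List J → M) → M
  | [], x, φ => V.leviAction x (φ []) + φ [x.e]
  | a :: L, x, φ => coact L x (fun L => φ (a :: L)) + coact L ⁅E k a, x⁆ φ

@[simp] lemma coact_nil (x : SL2J k J) (φ : List J → M) :
    V.coact [] x φ = V.leviAction x (φ []) + φ [x.e] := rfl

@[simp] lemma coact_cons (a : J) (L : List J) (x : SL2J k J) (φ : List J → M) :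
    V.coact (a :: L) x φ = V.coact L x (fun L => φ (a :: L)) + V.coact L ⁅E k a, x⁆ φ := rfl

lemma coact_add (L : List J) (x : SL2J k J) (φ ψ : List J → M) :
    V.coact L x (φ + ψ) = V.coact L x φ + V.coact L x ψ := by
  induction L generalizing x φ ψ with
  | nil => simp; abel
  | cons a L ih =>
    have h : (fun L => (φ + ψ) (a :: L)) = (fun L => φ (a :: L)) + fun L => ψ (a :: L) := rfl
    rw [coact_cons, coact_cons, coact_cons, h, ih, ih]
    abel

lemma coact_smul (L : List J) (x : SL2J k J) (r : k) (φ : List J → M) :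
    V.coact L x (r • φ) = r • V.coact L x φ := by
  induction L generalizing x φ with
  | nil => simp
  | cons a L ih =>
    have h : (fun L => (r • φ) (a :: L)) = r • fun L => φ (a :: L) := rfl
    rw [coact_cons, coact_cons, h, ih, ih, smul_add]

variable (k J M) in
/-- The symmetric multilinear functions of finitely many elements of `J`. -/
def symmFun : Submodule k (List J → M) where
  carrier := {φ | (∀ L₁ L₂ a b, φ (L₁ ++ (a + b) :: L₂) = φ (L₁ ++ a :: L₂) + φ (L₁ ++ b :: L₂)) ∧
    (∀ L₁ L₂ (r : k) a, φ (L₁ ++ (r • a) :: L₂) = r • φ (L₁ ++ a :: L₂)) ∧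
    ∀ L₁ L₂ a b, φ (L₁ ++ a :: b :: L₂) = φ (L₁ ++ b :: a :: L₂)}
  add_mem' {φ ψ} hφ hψ := by
    refine ⟨fun L₁ L₂ a b => ?_, fun L₁ L₂ r a => ?_, fun L₁ L₂ a b => ?_⟩
    · simp only [Pi.add_apply, hφ.1, hψ.1]; abel
    · simp only [Pi.add_apply, hφ.2.1, hψ.2.1, smul_add]
    · simp only [Pi.add_apply, hφ.2.2 L₁ L₂ a b, hψ.2.2 L₁ L₂ a b]
  zero_mem' := by simp
  smul_mem' r φ hφ := by
    refine ⟨fun L₁ L₂ a b => ?_, fun L₁ L₂ s a => ?_, fun L₁ L₂ a b => ?_⟩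
    · simp only [Pi.smul_apply, hφ.1, smul_add]
    · simp only [Pi.smul_apply, hφ.2.1, smul_comm r s]
    · simp only [Pi.smul_apply, hφ.2.2 L₁ L₂ a b]

lemma symmFun_cons {φ : List J → M} (hφ : φ ∈ symmFun k J M) (a : J) :
    (fun L => φ (a :: L)) ∈ symmFun k J M :=
  ⟨fun L₁ => hφ.1 (a :: L₁), fun L₁ => hφ.2.1 (a :: L₁), fun L₁ => hφ.2.2 (a :: L₁)⟩

/-- Linearity in $x$ needs multilinearity of $\varphi$, because $x$ enters through the value `φ
[x.e]`. -/
lemma coact_add_left {φ : List J → M} (hφ : φ ∈ symmFun k J M) (L : List J) (x y : SL2J k J) :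
    V.coact L (x + y) φ = V.coact L x φ + V.coact L y φ := by
  induction L generalizing x y φ with
  | nil =>
    have := hφ.1 [] [] x.e y.e
    simp only [List.nil_append] at this
    simp [this]; abel
  | cons a L ih =>
    simp only [coact_cons, lie_add]
    rw [ih hφ, ih (symmFun_cons hφ a)]
    abel

lemma coact_smul_left {φ : List J → M} (hφ : φ ∈ symmFun k J M) (L : List J) (r : k)
    (x : SL2J k J) : V.coact L (r • x) φ = r • V.coact L x φ := by
  induction L generalizing x φ with
  | nil =>
    have := hφ.2.1 [] [] r x.e
    simp only [List.nil_append] at this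
    simp [this]
  | cons a L ih =>
    simp only [coact_cons, lie_smul]
    rw [ih hφ, ih (symmFun_cons hφ a), smul_add]

/-- Symmetry is preserved because $\mathfrak G_1$ is abelian: `⁅E k a, ·⁆` and `⁅E k b, ·⁆` commute.
-/
lemma coact_mem_symmFun {φ : List J → M} (hφ : φ ∈ symmFun k J M) (x : SL2J k J) :
    (fun L => V.coact L x φ) ∈ symmFun k J M := by
  refine ⟨fun L₁ L₂ a b => ?_, fun L₁ L₂ r a => ?_, fun L₁ L₂ a b => ?_⟩
  · induction L₁ generalizing x φ with
    | nil =>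
      have : (fun L => φ ((a + b) :: L)) = (fun L => φ (a :: L)) + fun L => φ (b :: L) :=
        funext fun L => hφ.1 [] L a b
      simp only [List.nil_append, coact_cons, E_add, add_lie, V.coact_add_left hφ, this, coact_add]
      abel
    | cons c L₁ ih =>
      simp only [List.cons_append, coact_cons] at ih ⊢
      rw [ih (symmFun_cons hφ c), ih hφ]
      abel
  · induction L₁ generalizing x φ with
    | nil =>
      have : (fun L => φ ((r • a) :: L)) = r • (fun L => φ (a :: L)) :=
        funext fun L => hφ.2.1 [] L r a
      simp only [List.nil_append, coact_cons, E_smul, smul_lie, V.coact_smul_left hφ, this,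
        coact_smul, smul_add]
    | cons c L₁ ih =>
      simp only [List.cons_append, coact_cons] at ih ⊢
      rw [ih (symmFun_cons hφ c), ih hφ, smul_add]
  · induction L₁ generalizing x φ with
    | nil =>
      have h1 : (fun L => φ (a :: b :: L)) = fun L => φ (b :: a :: L) :=
        funext fun L => hφ.2.2 [] L a b
      have h2 : ⁅E k b, ⁅E k a, x⁆⁆ = ⁅E k a, ⁅E k b, x⁆⁆ := by
        rw [leibniz_lie, lie_E_E, zero_lie, zero_add]
      simp only [List.nil_append, coact_cons, h1, h2]
      abel
    | cons c L₁ ih =>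
      simp only [List.cons_append, coact_cons] at ih ⊢
      rw [ih (symmFun_cons hφ c), ih hφ]

/-- The induction step is the Leibniz rule for $e(a)$. On the empty list, the terms coming from
one-element lists supply the defect in `leviAction_lie`, and symmetry of $\varphi$ cancels the
values on two arguments. -/
lemma coact_lie {φ : List J → M} (hφ : φ ∈ symmFun k J M) (L : List J) (x y : SL2J k J) :
    V.coact L x (fun L => V.coact L y φ)
      = V.coact L ⁅x, y⁆ φ + V.coact L y (fun L => V.coact L x φ) := by
  induction L generalizing x y φ with
  | nil =>
    have hs : φ [x.e, y.e] = φ [y.e, x.e] := hφ.2.2 [] [] x.e y.e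
    have he : φ [⁅x, y⁆.e] + φ [⁅E k y.e, x⁆.e] = φ [⁅E k x.e, y⁆.e] := by
      have := hφ.1 [] [] ⁅x, y⁆.e ⁅E k y.e, x⁆.e
      simp only [List.nil_append] at this
      rw [← this]
      congr 2
      simp only [lie_e, E, zero_mul, mul_zero, map_zero, LinearMap.zero_apply, mul_comm]
      module
    simp only [coact_nil, coact_cons, V.leviAction_lie x y, LinearMap.add_apply, LinearMap.sub_apply,
      Module.End.mul_apply, map_add, hs, ← he]
    abel
  | cons a L ih =>
    have h : ∀ w : SL2J k J, (fun L => V.coact (a :: L) w φ)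
        = (fun L => V.coact L w fun L => φ (a :: L)) + fun L => V.coact L ⁅E k a, w⁆ φ :=
      fun w => rfl
    rw [coact_cons, coact_cons, coact_cons, h, h, coact_add, coact_add, ih hφ x ⁅E k a, y⁆,
      ih hφ ⁅E k a, x⁆ y, ih (symmFun_cons hφ a), leibniz_lie (E k a) x y, V.coact_add_left hφ]
    abel

/-- The module coinduced from the `𝔊₋₁ ⊕ 𝔊₀`-module `M` on which `𝔊₋₁` acts as zero. -/
def Coinduced (_ : JSpace k J M) : Type _ := symmFun k J M

instance : AddCommGroup V.Coinduced := inferInstanceAs (AddCommGroup (symmFun k J M))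

instance : Module k V.Coinduced := inferInstanceAs (Module k (symmFun k J M))

instance : LieRingModule (SL2J k J) V.Coinduced where
  bracket x φ := ⟨fun L => V.coact L x φ.1, V.coact_mem_symmFun φ.2 x⟩
  add_lie x y φ := Subtype.ext (funext fun L => V.coact_add_left φ.2 L x y)
  lie_add x φ ψ := Subtype.ext (funext fun L => V.coact_add L x φ.1 ψ.1)
  leibniz_lie x y φ := Subtype.ext (funext fun L => V.coact_lie φ.2 L x y)

instance : LieModule k (SL2J k J) V.Coinduced where
  smul_lie r x φ := Subtype.ext (funext fun L => V.coact_smul_left φ.2 L r x)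
  lie_smul r x φ := Subtype.ext (funext fun L => V.coact_smul L x r φ.1)

namespace Coinduced

variable {V}

/-- The value of the function on a list. -/
def eval (φ : V.Coinduced) : List J → M := φ.1

@[ext] lemma ext {φ ψ : V.Coinduced} (h : ∀ L, φ.eval L = ψ.eval L) : φ = ψ :=
  Subtype.ext (funext h)

lemma eval_lie (x : SL2J k J) (φ : V.Coinduced) (L : List J) :
    (⁅x, φ⁆ : V.Coinduced).eval L = V.coact L x φ.eval := rfl

@[simp] lemma eval_zero (L : List J) : (0 : V.Coinduced).eval L = 0 := rfl

lemma eval_swap (φ : V.Coinduced) (L₁ L₂ : List J) (a b : J) :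
    φ.eval (L₁ ++ a :: b :: L₂) = φ.eval (L₁ ++ b :: a :: L₂) := φ.2.2.2 L₁ L₂ a b

/-- This confirms the intended meaning of the lists: the values of $\varphi$ are those at the empty
list after applying raising operators. The commutator terms vanish since the $e(a)$ commute, and
symmetry of $\varphi$ does the rest. -/
lemma eval_cons (φ : V.Coinduced) (a : J) (L : List J) :
    φ.eval (a :: L) = (⁅E k a, φ⁆ : V.Coinduced).eval L := by
  rw [eval_lie]
  induction L generalizing φ with
  | nil =>
    simp [leviAction_apply, E]
  | cons b L ih =>
    let ψ : V.Coinduced := ⟨_, symmFun_cons φ.2 b⟩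
    have h : (fun L => φ.eval (b :: L)) = ψ.eval := rfl
    rw [coact_cons, h, ← ih, lie_E_E]
    have h0 : V.coact L 0 φ.eval = 0 := by
      have := V.coact_smul_left φ.2 L (0 : k) 0
      rwa [zero_smul, zero_smul] at this
    rw [h0, add_zero]
    exact φ.eval_swap [] L a b

variable (V) in
/-- The embedding of `M` into the coinduced module. -/
def const : M →ₗ[k] V.Coinduced where
  toFun m := ⟨fun L => match L with
    | [] => m
    | _ :: _ => 0, by
      refine ⟨fun L₁ L₂ a b => ?_, fun L₁ L₂ r a => ?_, fun L₁ L₂ a b => ?_⟩ <;> cases L₁ <;>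
        simp⟩
  map_add' m m' := by ext L; cases L <;> first | rfl | exact (add_zero _).symm
  map_smul' r m := by ext L; cases L <;> first | rfl | exact (smul_zero r).symm

@[simp] lemma eval_const_nil (m : M) : (const V m).eval [] = m := rfl
@[simp] lemma eval_const_cons (m : M) (a : J) (L : List J) : (const V m).eval (a :: L) = 0 := rfl

lemma const_injective : Function.Injective (const V) := fun m m' h => by
  rw [← eval_const_nil (V := V) m, h, eval_const_nil]

/-- On nonempty lists both sides vanish, because $[e(a),x]\in\mathfrak G_1$ when $x$ has no
$f$-component, and `leviAction` is zero on $\mathfrak G_1$. This is what makes the universal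
property of $V(M)$ applicable. -/
lemma lie_const (x : SL2J k J) (hx : x.f = 0) (m : M) :
    ⁅x, const V m⁆ = const V (V.leviAction x m) := by
  ext L
  induction L generalizing x with
  | nil => simp [eval_lie]
  | cons a L ih =>
    have h : (fun L => (const V m).eval (a :: L)) = 0 := rfl
    rw [eval_const_cons, eval_lie, coact_cons, h, ← eval_lie, ih _ (by simp [lie_f, hx, E])]
    have h0 : V.coact L x 0 = 0 := by simpa using V.coact_smul L x (0 : k) 0
    have h1 : V.leviAction ⁅E k a, x⁆ = 0 := by simp [leviAction_apply, lie_h, lie_z, hx, E]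
    rw [h0, h1, LinearMap.zero_apply, map_zero, eval_zero, add_zero]

end Coinduced

/-! ### The universal property of $V(M)$ and its map to the coinduced module. -/

section Lift

variable {N : Type*} [AddCommGroup N] [Module k N] [LieRingModule (SL2J k J) N]
  [LieModule k (SL2J k J) N]

/-- The linear map `U(𝔊) ⊗ M → N` given by a linear map from `M` to a `𝔊`-module `N`. -/
def tensorLift (g : M →ₗ[k] N) : UniversalEnvelopingAlgebra k (SL2J k J) ⊗[k] M →ₗ[k] N :=
  TensorProduct.lift ((LinearMap.lcomp k N g) ∘ₗ
    (UniversalEnvelopingAlgebra.lift k (LieModule.toEnd k (SL2J k J) N)).toLinearMap)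

lemma tensorLift_tmul (g : M →ₗ[k] N) (u : UniversalEnvelopingAlgebra k (SL2J k J)) (m : M) :
    tensorLift g (u ⊗ₜ[k] m) =
      UniversalEnvelopingAlgebra.lift k (LieModule.toEnd k (SL2J k J) N) u (g m) := rfl

lemma tensorLift_smul (g : M →ₗ[k] N) (u : UniversalEnvelopingAlgebra k (SL2J k J))
    (t : UniversalEnvelopingAlgebra k (SL2J k J) ⊗[k] M) :
    tensorLift g (u • t) =
      UniversalEnvelopingAlgebra.lift k (LieModule.toEnd k (SL2J k J) N) u (tensorLift g t) := by
  induction t using TensorProduct.induction_on with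
  | zero => simp
  | tmul u' m =>
    rw [TensorProduct.smul_tmul', tensorLift_tmul, tensorLift_tmul, smul_eq_mul, map_mul,
      Module.End.mul_apply]
  | add x y hx hy => rw [smul_add, map_add, map_add, map_add, hx, hy]

lemma tensorLift_eq_zero (g : M →ₗ[k] N)
    (hg : ∀ (x : SL2J k J) (m : M), x.f = 0 → ⁅x, g m⁆ = g (V.leviAction x m))
    (t : UniversalEnvelopingAlgebra k (SL2J k J) ⊗[k] M) (ht : t ∈ V.vermaRel) :
    tensorLift g t = 0 := by
  induction ht using Submodule.span_induction with
  | mem t ht =>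
    obtain ⟨x, m, rfl⟩ := ht
    rw [map_sub, tensorLift_tmul, tensorLift_tmul, UniversalEnvelopingAlgebra.lift_ι_apply,
      map_one, LieModule.toEnd_apply_apply, hg x m x.2, Module.End.one_apply, sub_eq_zero]
    rfl
  | zero => rw [map_zero]
  | add x y _ _ hx hy => rw [map_add, hx, hy, add_zero]
  | smul u t _ ht => rw [tensorLift_smul, ht, map_zero]

/-- The universal property of the generalized Verma module. -/
def vermaLift (g : M →ₗ[k] N)
    (hg : ∀ (x : SL2J k J) (m : M), x.f = 0 → ⁅x, g m⁆ = g (V.leviAction x m)) :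
    V.Verma →ₗ⁅k, SL2J k J⁆ N :=
  { ((V.vermaRel.restrictScalars k).liftQ (tensorLift g) (V.tensorLift_eq_zero g hg)) ∘ₗ
      (Submodule.Quotient.restrictScalarsEquiv k V.vermaRel).symm.toLinearMap with
    map_lie' := by
      intro x v
      obtain ⟨t, rfl⟩ := Submodule.mkQ_surjective _ v
      change tensorLift g (UniversalEnvelopingAlgebra.ι k x • t) = ⁅x, tensorLift g t⁆
      rw [tensorLift_smul, UniversalEnvelopingAlgebra.lift_ι_apply, LieModule.toEnd_apply_apply] }

lemma vermaLift_toVerma (g : M →ₗ[k] N)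
    (hg : ∀ (x : SL2J k J) (m : M), x.f = 0 → ⁅x, g m⁆ = g (V.leviAction x m)) (m : M) :
    V.vermaLift g hg (V.toVerma m) = g m := by
  change tensorLift g (1 ⊗ₜ m) = g m
  rw [tensorLift_tmul, map_one, Module.End.one_apply]

end Lift

/-- The canonical map from the Verma module to the coinduced module. -/
def vermaToCoinduced : V.Verma →ₗ⁅k, SL2J k J⁆ V.Coinduced :=
  V.vermaLift (Coinduced.const V) fun x m hx => Coinduced.lie_const x hx m

lemma vermaToCoinduced_toVerma (m : M) :
    V.vermaToCoinduced (V.toVerma m) = Coinduced.const V m := V.vermaLift_toVerma _ _ m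

lemma toVerma_injective : Function.Injective V.toVerma := fun m m' h =>
  Coinduced.const_injective (V := V) <| by
    rw [← vermaToCoinduced_toVerma, h, vermaToCoinduced_toVerma]

lemma lie_toVerma (x : SL2J k J) (hx : x.f = 0) (m : M) :
    ⁅x, V.toVerma m⁆ = V.toVerma (V.leviAction x m) := by
  have h : UniversalEnvelopingAlgebra.ι k x ⊗ₜ[k] m - 1 ⊗ₜ[k] V.leviAction x m ∈ V.vermaRel :=
    Submodule.subset_span ⟨⟨x, hx⟩, m, rfl⟩
  have h2 := (Submodule.Quotient.eq _).2 h
  refine Eq.trans ?_ h2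
  change Submodule.Quotient.mk (UniversalEnvelopingAlgebra.ι k x •
    ((1 : UniversalEnvelopingAlgebra k (SL2J k J)) ⊗ₜ[k] m)) = _
  rw [TensorProduct.smul_tmul', smul_eq_mul, mul_one]

/-- A `𝔊`-submodule of the Verma module containing the image of `M` is everything. -/
lemma verma_induction {P : V.Verma → Prop} (add : ∀ v w, P v → P w → P (v + w))
    (smul : ∀ (r : k) v, P v → P (r • v)) (lie : ∀ (x : SL2J k J) v, P v → P ⁅x, v⁆)
    (mem : ∀ m, P (V.toVerma m)) (v : V.Verma) : P v := by
  have key : ∀ (u : UniversalEnvelopingAlgebra k (SL2J k J)) (v : V.Verma), P v → P (u • v) := by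
    intro u
    obtain ⟨t, rfl⟩ : ∃ t, UniversalEnvelopingAlgebra.mkAlgHom k (SL2J k J) t = u :=
      Quotient.exists_rep u
    induction t using TensorAlgebra.induction with
    | algebraMap r => intro v hv; rw [AlgHom.commutes, algebraMap_smul]; exact smul r v hv
    | ι x => exact fun v hv => lie x v hv
    | mul a b ha hb => intro v hv; rw [map_mul, mul_smul]; exact ha _ (hb _ hv)
    | add a b ha hb => intro v hv; rw [map_add, add_smul]; exact add _ _ (ha _ hv) (hb _ hv)
  obtain ⟨t, rfl⟩ := Submodule.mkQ_surjective _ v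
  induction t using TensorProduct.induction_on with
  | zero => simpa using smul 0 _ (mem 0)
  | tmul u m =>
    have h := key u _ (mem m)
    have h1 : u • V.toVerma m = V.vermaRel.mkQ
        (u • ((1 : UniversalEnvelopingAlgebra k (SL2J k J)) ⊗ₜ[k] m)) := rfl
    rwa [h1, TensorProduct.smul_tmul', smul_eq_mul, mul_one] at h
  | add x y hx hy => rw [map_add]; exact add _ _ hx hy

end JSpace

open SL2J

/-! ### Weight spaces. -/

section Weights

variable {k J : Type*} [Field k] [CharZero k] [NonAssocCommRing J] [Module k J]
  [IsScalarTower k J J] [SMulCommClass k J J] [IsCommJordan J]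
  {N : Type*} [AddCommGroup N] [Module k N] [LieRingModule (SL2J k J) N] [LieModule k (SL2J k J) N]

lemma mem_weightSpace {j : ℤ} {v : N} :
    v ∈ weightSpace k J N j ↔ ⁅H k (1 : J), v⁆ = (j : k) • v := Iff.rfl

lemma lie_E_mem_weightSpace {j : ℤ} {v : N} (hv : v ∈ weightSpace k J N j) (a : J) :
    ⁅E k a, v⁆ ∈ weightSpace k J N (j + 2) := by
  rw [mem_weightSpace] at hv ⊢
  rw [leibniz_lie, hv, lie_H_E, one_mul, smul_lie, lie_smul]
  push_cast
  module

lemma lie_F_mem_weightSpace {j : ℤ} {v : N} (hv : v ∈ weightSpace k J N j) (a : J) :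
    ⁅F k a, v⁆ ∈ weightSpace k J N (j - 2) := by
  rw [mem_weightSpace] at hv ⊢
  rw [leibniz_lie, hv, lie_H_F, one_mul, smul_lie, lie_smul]
  push_cast
  module

lemma map_mem_weightSpace {N' : Type*} [AddCommGroup N'] [Module k N']
    [LieRingModule (SL2J k J) N'] [LieModule k (SL2J k J) N'] (Φ : N →ₗ⁅k, SL2J k J⁆ N') {j : ℤ}
    {v : N} (hv : v ∈ weightSpace k J N j) : Φ v ∈ weightSpace k J N' j := by
  rw [mem_weightSpace] at hv ⊢
  rw [← LieModuleHom.map_lie, hv, map_smul]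

variable (k J N) in
lemma weightSpace_iSupIndep : iSupIndep (weightSpace k J N) := by
  have h := (Module.End.eigenspaces_iSupIndep
    (LieModule.toEnd k (SL2J k J) N (H k (1 : J)))).comp (f := fun j : ℤ => (j : k))
    Int.cast_injective
  have he : weightSpace k J N = (LieModule.toEnd k (SL2J k J) N (H k (1 : J))).eigenspace ∘
      fun j : ℤ => (j : k) := by
    funext j
    ext v
    rw [mem_weightSpace, Function.comp_apply, Module.End.mem_eigenspace_iff,
      LieModule.toEnd_apply_apply]
  rwa [he]

lemma isBoundedOfLevel_iff {n : ℕ} : IsBoundedOfLevel k J N n ↔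
    (⨆ j : Set.Icc (-(n : ℤ)) (n : ℤ), weightSpace k J N j) = ⊤ ∧ weightSpace k J N n ≠ ⊥ := by
  unfold IsBoundedOfLevel
  refine and_congr ?_ Iff.rfl
  rw [DirectSum.isInternal_submodule_iff_iSupIndep_and_iSup_eq_top, and_iff_right]
  exact (weightSpace_iSupIndep k J N).comp Subtype.val_injective

/-- The weight spaces in the allowed range already span, and eigenspaces for distinct eigenvalues
are independent. -/
lemma IsBoundedOfLevel.weightSpace_eq_bot {n : ℕ} (h : IsBoundedOfLevel k J N n) {j : ℤ}
    (hj : j ∉ Set.Icc (-(n : ℤ)) n) : weightSpace k J N j = ⊥ := by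
  have h1 := weightSpace_iSupIndep k J N j
  have h2 : (⊤ : Submodule k N) ≤ ⨆ i, ⨆ (_ : i ≠ j), weightSpace k J N i := by
    rw [← (isBoundedOfLevel_iff.1 h).1]
    refine iSup_le fun i => le_iSup₂_of_le (i : ℤ) ?_ le_rfl
    rintro rfl
    exact hj i.2
  rw [top_le_iff.1 h2] at h1
  exact disjoint_top.1 h1

end Weights

/-! ### The grading of $V(M)$, and dominance in terms of bounded quotients. -/

namespace JSpace

variable {k J M : Type*} [Field k] [NonAssocCommRing J] [Module k J]
  [IsScalarTower k J J] [SMulCommClass k J J] [AddCommGroup M] [Module k M]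
  [CharZero k] [IsCommJordan J] (V : JSpace k J M)

/-- The span of all `f(a₁) ⋯ f(aᵣ) m` in the Verma module. -/
def degPiece : ℕ → Submodule k V.Verma
  | 0 => LinearMap.range V.toVerma
  | r + 1 => Submodule.span k {w | ∃ (a : J) (v : V.Verma), v ∈ degPiece r ∧ w = ⁅F k a, v⁆}

variable {V}

lemma toVerma_mem (m : M) : V.toVerma m ∈ V.degPiece 0 := ⟨m, rfl⟩

lemma lie_F_mem {r : ℕ} {v : V.Verma} (hv : v ∈ V.degPiece r) (a : J) :
    ⁅F k a, v⁆ ∈ V.degPiece (r + 1) := Submodule.subset_span ⟨a, v, hv, rfl⟩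

lemma degPiece_induction {r : ℕ} {p : V.Verma → Prop} {w : V.Verma}
    (hw : w ∈ V.degPiece (r + 1))
    (mem : ∀ (a : J) (v : V.Verma), v ∈ V.degPiece r → p ⁅F k a, v⁆) (zero : p 0)
    (add : ∀ v w, p v → p w → p (v + w)) (smul : ∀ (c : k) (v : V.Verma), p v → p (c • v)) :
    p w := by
  refine Submodule.span_induction (p := fun w _ => p w) ?_ zero (fun v w _ _ => add v w)
    (fun c v _ => smul c v) hw
  rintro _ ⟨a, v, hv, rfl⟩
  exact mem a v hv

lemma lie_mem_of_levi (x : SL2J k J) (he : x.e = 0) (hf : x.f = 0) {r : ℕ} {v : V.Verma}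
    (hv : v ∈ V.degPiece r) : ⁅x, v⁆ ∈ V.degPiece r := by
  induction r generalizing v with
  | zero =>
    obtain ⟨m, rfl⟩ := hv
    rw [lie_toVerma _ _ hf]
    exact toVerma_mem _
  | succ r ih =>
    refine degPiece_induction (p := fun v => ⁅x, v⁆ ∈ V.degPiece (r + 1)) hv
      (fun a v hv => ?_) (by simp) (fun v w hv hw => ?_) (fun c v hv => ?_)
    · have h : ⁅x, F k a⁆ = F k ⁅x, F k a⁆.f := by
        ext <;> simp [lie_e, lie_h, lie_z, lie_f, F, he, hf]
      rw [leibniz_lie, h]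
      exact add_mem (lie_F_mem hv _) (lie_F_mem (ih hv) _)
    · rw [lie_add]; exact add_mem hv hw
    · rw [lie_smul]; exact Submodule.smul_mem _ _ hv

lemma lie_H_mem {r : ℕ} {v : V.Verma} (hv : v ∈ V.degPiece r) (a : J) :
    ⁅H k a, v⁆ ∈ V.degPiece r := lie_mem_of_levi _ rfl rfl hv

lemma lie_E_eq_zero {v : V.Verma} (hv : v ∈ V.degPiece 0) (a : J) : ⁅E k a, v⁆ = 0 := by
  obtain ⟨m, rfl⟩ := hv
  rw [lie_toVerma _ _ rfl]
  simp [leviAction_apply, E]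

lemma lie_E_mem {r : ℕ} {v : V.Verma} (hv : v ∈ V.degPiece (r + 1)) (a : J) :
    ⁅E k a, v⁆ ∈ V.degPiece r := by
  induction r generalizing v with
  | zero =>
    refine degPiece_induction (p := fun v => ⁅E k a, v⁆ ∈ V.degPiece 0) hv
      (fun b v hv => ?_) (by simp) (fun v w hv hw => ?_) (fun c v hv => ?_)
    · rw [leibniz_lie, lie_E_eq_zero hv, lie_zero, add_zero]
      exact lie_mem_of_levi _ (by simp [lie_e, E, F]) (by simp [lie_f, E, F]) hv
    · rw [lie_add]; exact add_mem hv hw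
    · rw [lie_smul]; exact Submodule.smul_mem _ _ hv
  | succ r ih =>
    refine degPiece_induction (p := fun v => ⁅E k a, v⁆ ∈ V.degPiece (r + 1)) hv
      (fun b v hv => ?_) (by simp) (fun v w hv hw => ?_) (fun c v hv => ?_)
    · rw [leibniz_lie]
      exact add_mem (lie_mem_of_levi _ (by simp [lie_e, E, F]) (by simp [lie_f, E, F]) hv)
        (lie_F_mem (ih hv) b)
    · rw [lie_add]; exact add_mem hv hw
    · rw [lie_smul]; exact Submodule.smul_mem _ _ hv

variable (V) in
-- The sum contains $M$ and is stable under each of the four components of an element of $\mathfrak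
-- G$.
lemma iSup_degPiece : ⨆ r, V.degPiece r = ⊤ := by
  refine top_le_iff.1 fun v _ => ?_
  have hle : ∀ {r} {w : V.Verma}, w ∈ V.degPiece r → w ∈ ⨆ r, V.degPiece r :=
    fun {r} {w} hw => (le_iSup V.degPiece r) hw
  refine V.verma_induction (fun v w => add_mem) (fun r v => Submodule.smul_mem _ r)
    (fun x v hv => ?_) (fun m => hle (toVerma_mem m)) v
  refine Submodule.iSup_induction _ (motive := fun v => ⁅x, v⁆ ∈ ⨆ r, V.degPiece r) hv
    (fun r v hv => ?_) (by simp) (fun v w hv hw => by rw [lie_add]; exact add_mem hv hw)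
  rw [eq_add x, add_lie, add_lie, add_lie]
  refine add_mem (add_mem (add_mem ?_ (hle (lie_H_mem hv _))) (hle (lie_F_mem hv _)))
    (hle (lie_mem_of_levi _ rfl rfl hv))
  cases r with
  | zero => rw [lie_E_eq_zero hv]; exact zero_mem _
  | succ r => exact hle (lie_E_mem hv _)

lemma degPiece_le_weightSpace {n : ℕ} (hn : V.IsOfLevel n) (r : ℕ) :
    V.degPiece r ≤ weightSpace k J V.Verma (n - 2 * r) := by
  induction r with
  | zero =>
    rintro _ ⟨m, rfl⟩
    have hn : V.ρ 1 = (n : k) • (1 : Module.End k M) := hn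
    rw [mem_weightSpace, lie_toVerma _ _ rfl]
    simp [leviAction_apply, H, hn]
  | succ r ih =>
    intro w hw
    refine degPiece_induction hw (fun a v hv => ?_) (zero_mem _) (fun v w => add_mem)
      (fun c v => Submodule.smul_mem _ c)
    convert lie_F_mem_weightSpace (ih hv) a using 2
    push_cast
    ring

/-- The surviving degrees $0\le r\le n$ have weights $n-2r\in[-n,n]$, and degree $0$ gives a nonzero
vector of weight $n$. -/
lemma isBoundedOfLevel_of_surjective {n : ℕ} (hn : V.IsOfLevel n) {N : Type*} [AddCommGroup N]
    [Module k N] [LieRingModule (SL2J k J) N] [LieModule k (SL2J k J) N] [Nontrivial M]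
    (Φ : V.Verma →ₗ⁅k, SL2J k J⁆ N) (hΦ : Function.Surjective Φ)
    (hinj : Function.Injective fun m => Φ (V.toVerma m))
    (h : ∀ r, n < r → ∀ v ∈ V.degPiece r, Φ v = 0) : IsBoundedOfLevel k J N n := by
  refine isBoundedOfLevel_iff.2 ⟨top_le_iff.1 fun w _ => ?_, fun hbot => ?_⟩
  · obtain ⟨v, rfl⟩ := hΦ w
    have hv : v ∈ ⨆ r, V.degPiece r := by rw [iSup_degPiece]; trivial
    refine Submodule.iSup_induction _ (motive := fun v => Φ v ∈ _) hv
      (fun r v hv => ?_) (by simp) (fun v w hv hw => by rw [map_add]; exact add_mem hv hw)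
    by_cases hr : n < r
    · rw [h r hr v hv]; exact zero_mem _
    · exact (le_iSup (fun j : Set.Icc (-(n : ℤ)) (n : ℤ) => weightSpace k J N j)
        ⟨n - 2 * r, by constructor <;> omega⟩)
        (map_mem_weightSpace Φ (degPiece_le_weightSpace hn r hv))
  · obtain ⟨m, hm⟩ := exists_ne (0 : M)
    have h0 := map_mem_weightSpace Φ (degPiece_le_weightSpace hn 0 (toVerma_mem m))
    rw [Nat.cast_zero, mul_zero, sub_zero, hbot, Submodule.mem_bot] at h0
    exact hm (hinj (by simpa using h0))

/-- Modulo the image of $M$, everything is a sum of vectors of weight different from $n$;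
independence of the weight spaces then leaves only the part from $M$. -/
lemma exists_toVerma_of_mem_weightSpace {n : ℕ} (hn : V.IsOfLevel n) {N : Type*} [AddCommGroup N]
    [Module k N] [LieRingModule (SL2J k J) N] [LieModule k (SL2J k J) N]
    (Φ : V.Verma →ₗ⁅k, SL2J k J⁆ N) (hΦ : Function.Surjective Φ) {w : N}
    (hw : w ∈ weightSpace k J N n) : ∃ m, Φ (V.toVerma m) = w := by
  have key : ∀ v : V.Verma, ∃ m, Φ v - Φ (V.toVerma m) ∈
      ⨆ j, ⨆ (_ : j ≠ (n : ℤ)), weightSpace k J N j := by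
    intro v
    have hv : v ∈ ⨆ r, V.degPiece r := by rw [iSup_degPiece]; trivial
    refine Submodule.iSup_induction _ (motive := fun v => ∃ m, Φ v - Φ (V.toVerma m) ∈
      ⨆ j, ⨆ (_ : j ≠ (n : ℤ)), weightSpace k J N j) hv (fun r v hv => ?_) ⟨0, by simp⟩ ?_
    · cases r with
      | zero => obtain ⟨m, rfl⟩ := hv; exact ⟨m, by simp⟩
      | succ r =>
        refine ⟨0, ?_⟩
        rw [map_zero, map_zero, sub_zero]
        exact (le_iSup₂_of_le (f := fun j (_ : j ≠ (n : ℤ)) => weightSpace k J N j)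
          ((n : ℤ) - 2 * ((r + 1 : ℕ) : ℤ)) (by omega) le_rfl)
          (map_mem_weightSpace Φ (degPiece_le_weightSpace hn _ hv))
    · rintro v w ⟨m, hm⟩ ⟨m', hm'⟩
      refine ⟨m + m', ?_⟩
      rw [map_add, map_add, map_add, add_sub_add_comm]
      exact add_mem hm hm'
  obtain ⟨v, rfl⟩ := hΦ w
  obtain ⟨m, hm⟩ := key v
  refine ⟨m, ?_⟩
  have h0 := map_mem_weightSpace Φ (degPiece_le_weightSpace hn 0 (toVerma_mem m))
  rw [Nat.cast_zero, mul_zero, sub_zero] at h0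
  have := Submodule.disjoint_def.1 (weightSpace_iSupIndep k J N n) _ (sub_mem hw h0) hm
  exact (sub_eq_zero.1 this).symm

lemma hasBoundedQuotient_of_hom {n : ℕ} (hn : V.IsOfLevel n) {N : Type*} [AddCommGroup N]
    [Module k N] [LieRingModule (SL2J k J) N] [LieModule k (SL2J k J) N] [Nontrivial M]
    (Φ : V.Verma →ₗ⁅k, SL2J k J⁆ N) (hinj : Function.Injective fun m => Φ (V.toVerma m))
    (h : ∀ r, n < r → ∀ v ∈ V.degPiece r, Φ v = 0) : V.HasBoundedQuotient n := by
  have hinj' : Function.Injective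
      fun m => LieSubmodule.Quotient.mk' Φ.ker (V.toVerma m) := fun m m' hm => hinj <| by
    have h1 : V.toVerma m - V.toVerma m' ∈ Φ.ker := (Submodule.Quotient.eq _).1 hm
    rw [LieModuleHom.mem_ker, map_sub, sub_eq_zero] at h1
    exact h1
  refine ⟨Φ.ker, isBoundedOfLevel_of_surjective hn (LieSubmodule.Quotient.mk' Φ.ker)
    (LieSubmodule.Quotient.surjective_mk' _) hinj' fun r hr v hv => ?_, hinj'⟩
  rw [LieSubmodule.Quotient.mk_eq_zero, LieModuleHom.mem_ker]
  exact h r hr v hv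

lemma hasBoundedQuotient_of_isDominant {n : ℕ} (hn : V.IsOfLevel n) [Nontrivial M]
    (h : V.IsDominant n) : V.HasBoundedQuotient n := by
  obtain ⟨N, _, _, _, _, hN, φ, hφ⟩ := h
  let g : M →ₗ[k] N := (weightSpace k J N n).subtype ∘ₗ φ.toLinearMap
  have hgm : ∀ m, g m ∈ weightSpace k J N n := fun m => (φ m).2
  have hH : ∀ a m, ⁅H k a, g m⁆ = g (V.ρ a m) := fun a m => (hφ a m).symm
  -- These vectors have weight $n+2$, outside the bounded range.
  have hE : ∀ a m, ⁅E k a, g m⁆ = 0 := fun a m => by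
    have h1 := lie_E_mem_weightSpace (hgm m) a
    rwa [hN.weightSpace_eq_bot (by simp), Submodule.mem_bot] at h1
  -- The action of $\{J,J\}$ is forced by that of $h\otimes J$, since $[h(a),h(b)]=4\{a,b\}$.
  have hZ : ∀ z m, ⁅(Z z : SL2J k J), g m⁆ = g (V.braceAction z m) := by
    intro z m
    induction z using JJ.induction with
    | zero =>
      have : (Z 0 : SL2J k J) = 0 := rfl
      simp [this]
    | add x y hx hy =>
      have : (Z (x + y) : SL2J k J) = Z x + Z y := by ext <;> simp [Z]
      rw [this, add_lie, hx, hy, map_add, LinearMap.add_apply, map_add]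
    | brace a b =>
      have h4 : (4 : k) ≠ 0 := by norm_num
      have h1 : (Z (brace k a b) : SL2J k J) = (4 : k)⁻¹ • ⁅H k a, H k b⁆ := by
        rw [lie_H_H, smul_smul, inv_mul_cancel₀ h4, one_smul]
      rw [h1, smul_lie, _root_.lie_lie, hH, hH, hH, hH, braceAction_brace, LinearMap.smul_apply,
        map_smul, LinearMap.sub_apply, map_sub, Module.End.mul_apply, Module.End.mul_apply]
  have hg : ∀ (x : SL2J k J) (m : M), x.f = 0 → ⁅x, g m⁆ = g (V.leviAction x m) := by
    intro x m hx
    have hF : F k (0 : J) = 0 := rfl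
    rw [eq_add x, add_lie, add_lie, add_lie, hx, hF, hE, hH, hZ, zero_lie, zero_add, add_zero,
      ← map_add]
    simp [leviAction_apply, E, H, Z]
  refine hasBoundedQuotient_of_hom hn (V.vermaLift g hg) (fun m m' hm => ?_) fun r hr v hv => ?_
  · simp only [vermaLift_toVerma] at hm
    exact φ.injective (Subtype.ext hm)
  · have h1 := map_mem_weightSpace (V.vermaLift g hg) (degPiece_le_weightSpace hn r hv)
    rwa [hN.weightSpace_eq_bot (by simp; omega), Submodule.mem_bot] at h1

end JSpace

universe u v w

lemma JSpace.isDominant_of_hasBoundedQuotient {k : Type u} {J : Type v} {M : Type w} [Field k]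
    [CharZero k] [NonAssocCommRing J] [Module k J] [IsScalarTower k J J] [SMulCommClass k J J]
    [IsCommJordan J] [AddCommGroup M] [Module k M] {V : JSpace k J M} {n : ℕ} (hn : V.IsOfLevel n)
    (h : V.HasBoundedQuotient n) : V.IsDominant n := by
  obtain ⟨X, hX, hinj⟩ := h
  refine ⟨V.Verma ⧸ X, inferInstance, inferInstance, inferInstance, inferInstance, hX, ?_⟩
  have hmem : ∀ m, LieSubmodule.Quotient.mk' X (V.toVerma m) ∈ weightSpace k J (V.Verma ⧸ X) n := by
    intro m
    have := map_mem_weightSpace (LieSubmodule.Quotient.mk' X)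
      (degPiece_le_weightSpace hn 0 (toVerma_mem m))
    rwa [Nat.cast_zero, mul_zero, sub_zero] at this
  let g : M →ₗ[k] weightSpace k J (V.Verma ⧸ X) n :=
    LinearMap.codRestrict _ ((LieSubmodule.Quotient.mk' X : V.Verma →ₗ[k] V.Verma ⧸ X) ∘ₗ V.toVerma)
      hmem
  have hg : Function.Bijective g := by
    refine ⟨fun m m' hm => hinj (congrArg Subtype.val hm), fun w => ?_⟩
    obtain ⟨m, hm⟩ := exists_toVerma_of_mem_weightSpace hn (LieSubmodule.Quotient.mk' X)
      (LieSubmodule.Quotient.surjective_mk' _) w.2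
    exact ⟨m, Subtype.ext hm⟩
  refine ⟨LinearEquiv.ofBijective g hg, fun a m => ?_⟩
  change LieSubmodule.Quotient.mk' X (V.toVerma (V.ρ a m)) =
    ⁅H k a, LieSubmodule.Quotient.mk' X (V.toVerma m)⁆
  rw [← LieModuleHom.map_lie, lie_toVerma _ _ rfl]
  simp [leviAction_apply, H]

/-! ### Powers of one element of a Jordan algebra. -/

section Powers

variable (k : Type*) {J : Type*} [Field k] [CharZero k] [NonAssocCommRing J] [Module k J]
  [IsScalarTower k J J] [SMulCommClass k J J] [IsCommJordan J]

include k in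
/-- The recursion for multiplication operators in a Jordan algebra. -/
lemma mul_mul_mul_eq (a b c x : J) :
    (a * b * c) * x = c * (a * b * x) + a * (b * c * x) + b * (c * a * x)
      - a * (c * (b * x)) - b * (c * (a * x)) := by
  have h1 := jordan_linear k a b x c
  have h2 := jordan_linear k a b c x
  simp only [mul_comm] at h1 h2 ⊢
  linear_combination (norm := module) h2 - h1

/-- The two claims are proved together because the recursion expresses $L_{a^{i+2}}$ through $L_a$,
$L_{a^2}$, $L_{a^i}$ and $L_{a^{i+1}}$. -/
lemma commute_mulLeft_jpow (a : J) (i : ℕ) :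
    Commute (LinearMap.mulLeft k a) (LinearMap.mulLeft k (jpow a i)) ∧
      Commute (LinearMap.mulLeft k (a * a)) (LinearMap.mulLeft k (jpow a i)) := by
  have hAB : Commute (LinearMap.mulLeft k (a * a)) (LinearMap.mulLeft k a) :=
    LinearMap.ext fun x => (jordan_identity a x).symm
  induction i using Nat.twoStepInduction with
  | zero =>
    have h1 : LinearMap.mulLeft k (jpow a 0) = 1 := LinearMap.ext fun x => one_mul x
    rw [h1]
    exact ⟨Commute.one_right _, Commute.one_right _⟩
  | one =>
    have h1 : jpow a 1 = a := mul_one a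
    rw [h1]
    exact ⟨Commute.refl _, hAB⟩
  | more i ih1 ih2 =>
    have h : LinearMap.mulLeft k (jpow a (i + 2)) =
        LinearMap.mulLeft k a * LinearMap.mulLeft k (jpow a (i + 1))
          + LinearMap.mulLeft k a * LinearMap.mulLeft k (jpow a (i + 1))
          + LinearMap.mulLeft k (jpow a i) * LinearMap.mulLeft k (a * a)
          - LinearMap.mulLeft k a * (LinearMap.mulLeft k a * LinearMap.mulLeft k (jpow a i))
          - LinearMap.mulLeft k (jpow a i) * (LinearMap.mulLeft k a * LinearMap.mulLeft k a) := by
      ext x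
      have := mul_mul_mul_eq k a (jpow a i) a x
      rw [mul_comm (jpow a i) a, mul_comm (a * jpow a i) a] at this
      simpa [jpow] using this
    have key : ∀ T : Module.End k J, Commute T (LinearMap.mulLeft k a) →
        Commute T (LinearMap.mulLeft k (a * a)) → Commute T (LinearMap.mulLeft k (jpow a i)) →
        Commute T (LinearMap.mulLeft k (jpow a (i + 1))) →
        Commute T (LinearMap.mulLeft k (jpow a (i + 2))) := by
      intro T h1 h2 h3 h4
      rw [h]
      exact ((((h1.mul_right h4).add_right (h1.mul_right h4)).add_right
        (h3.mul_right h2)).sub_right (h1.mul_right (h1.mul_right h3))).sub_right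
        (h3.mul_right (h1.mul_right h1))
    exact ⟨key _ (Commute.refl _) hAB.symm ih1.1 ih2.1, key _ hAB (Commute.refl _) ih1.2 ih2.2⟩

include k in
/-- Jordan algebras are power associative. -/
lemma jpow_mul_jpow (a : J) (i j : ℕ) : jpow a i * jpow a j = jpow a (i + j) := by
  induction j with
  | zero => exact mul_one _
  | succ j ih =>
    have h := LinearMap.congr_fun (commute_mulLeft_jpow k a i).1.eq (jpow a j)
    simp only [Module.End.mul_apply, LinearMap.mulLeft_apply] at h
    change jpow a i * (a * jpow a j) = a * jpow a (i + j)
    rw [← h, ih]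

lemma brace_one_left (c : J) : brace k 1 c = 0 := by
  have h := brace_cyc k 1 1 c
  have s := brace_skew k c 1
  rw [mul_one, one_mul, mul_one] at h
  linear_combination (norm := module) s + s - h

/-- The brace vanishes on the powers of an element. -/
lemma brace_jpow_jpow (a : J) (i j : ℕ) : brace k (jpow a i) (jpow a j) = 0 := by
  have h1 : jpow a 1 = a := mul_one a
  -- The cyclic identity `brace_cyc` for $a,a^i,a^j$ shifts one factor $a$ from left to right.
  have step : ∀ i j, brace k (jpow a (i + 1)) (jpow a j)
      = brace k (jpow a i) (jpow a (j + 1)) - brace k (jpow a (i + j)) (jpow a 1) := by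
    intro i j
    have h := brace_cyc k a (jpow a i) (jpow a j)
    have s := brace_skew k (jpow a i) (a * jpow a j)
    rw [jpow_mul_jpow k, mul_comm (jpow a j) a] at h
    rw [h1]
    change brace k (a * jpow a i) (jpow a j) = brace k (jpow a i) (a * jpow a j) - _
    linear_combination (norm := module) h - s
  have iter : ∀ i j, brace k (jpow a i) (jpow a (j + 1))
      = -(i : k) • brace k (jpow a (i + j)) (jpow a 1) := by
    intro i
    induction i with
    | zero => intro j; simpa [jpow] using brace_one_left k (jpow a (j + 1))
    | succ i ih =>
      intro j
      rw [step, ih, show i + (j + 1) = i + 1 + j by omega]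
      push_cast
      module
  -- Moving all factors across gives $\{a^s,a\}=-s\{a^s,a\}$, and $s+1\ne0$ in characteristic $0$.
  have last : ∀ s, brace k (jpow a s) (jpow a 1) = 0 := by
    intro s
    have h := iter s 0
    rw [zero_add, add_zero] at h
    have h2 : ((s : k) + 1) • brace k (jpow a s) (jpow a 1) = 0 := by
      linear_combination (norm := module) h
    exact (smul_eq_zero.1 h2).resolve_left (Nat.cast_add_one_ne_zero s)
  cases j with
  | zero =>
    rw [brace_skew]
    exact neg_eq_zero.2 (brace_one_left k _)
  | succ j => rw [iter, last, smul_zero]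

end Powers

/-! ### Commutation formulas of $\mathfrak{sl}_2$ type in a ring. -/

section Commutation

variable {R : Type*} [Ring R] {x f h y : R}

lemma mul_pow_of_comm (hhx : h * x = x * h + 2 • y) (hxy : Commute x y) (N : ℕ) :
    h * x ^ N = x ^ N * h + (2 * N) • (y * x ^ (N - 1)) := by
  induction N with
  | zero => simp
  | succ N ih =>
    rw [pow_succ, ← mul_assoc, ih, add_mul, mul_assoc, hhx, mul_add, smul_mul_assoc, mul_assoc,
      ← pow_succ, mul_smul_comm, (hxy.pow_left N).eq, add_tsub_cancel_right, ← mul_assoc]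
    cases N with
    | zero => simp
    | succ N =>
      rw [add_tsub_cancel_right]
      module

/-- Stated abstractly since it is used twice: with $x=e(1)$ moving past $f(a^j)$, and with $x=f(a)$
moving past $e(a^j)$. The truncated exponents are harmless, as their coefficients vanish whenever
truncation occurs. -/
lemma pow_mul_of_comm (hxf : x * f = f * x + h) (hhx : h * x = x * h + 2 • y) (hxy : Commute x y)
    (N : ℕ) :
    x ^ N * f = f * x ^ N + N • (x ^ (N - 1) * h) + (N * (N - 1)) • (y * x ^ (N - 2)) := by
  induction N with
  | zero => simp
  | succ N ih =>
    have e1 : x * (N • (x ^ (N - 1) * h)) = N • (x ^ N * h) := by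
      cases N with
      | zero => simp
      | succ N => rw [mul_smul_comm, ← mul_assoc, add_tsub_cancel_right, ← pow_succ']
    have e2 : x * ((N * (N - 1)) • (y * x ^ (N - 2))) = (N * (N - 1)) • (y * x ^ (N - 1)) := by
      match N with
      | 0 => simp
      | 1 => simp
      | N + 2 =>
        rw [mul_smul_comm, ← mul_assoc, hxy.eq, mul_assoc, ← pow_succ']
        rfl
    rw [pow_succ', mul_assoc, ih, mul_add, mul_add, e1, e2, ← mul_assoc, hxf, add_mul, mul_assoc,
      ← pow_succ', mul_pow_of_comm hhx hxy, add_tsub_cancel_right,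
      show N + 1 - 2 = N - 1 by omega]
    have e3 : (2 * N + N * (N - 1)) = (N + 1) * N := by
      cases N with
      | zero => rfl
      | succ N => rw [add_tsub_cancel_right]; ring
    rw [← e3]
    module

end Commutation

/-- The quantities `N! q_{N,j}`, where `q_{N,j} = ∑ᵢ (-1)ⁱ e_{N-i} p_{j+i}` and the `eᵢ` are the
elementary symmetric functions with power sums `pᵢ`. -/
def newtonSum {A : Type*} [Ring A] (p : ℕ → A) : ℕ → ℕ → A
  | 0, j => p j
  | N + 1, j => newtonSum p N 1 * p j - (N + 1) • newtonSum p N (j + 1)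

namespace JSpace

variable {k J M : Type*} [Field k] [NonAssocCommRing J] [Module k J]
  [IsScalarTower k J J] [SMulCommClass k J J] [AddCommGroup M] [Module k M]
  [CharZero k] [IsCommJordan J] (V : JSpace k J M)

lemma commute_ρ_jpow (a : J) (i j : ℕ) : Commute (V.ρ (jpow a i)) (V.ρ (jpow a j)) := by
  have h := V.braceAction_brace (jpow a i) (jpow a j)
  rw [brace_jpow_jpow, map_zero, eq_comm, smul_eq_zero] at h
  exact sub_eq_zero.1 (h.resolve_left (by norm_num))

end JSpace

/-! ### The action of $e(1)^{r+1}f(a)^{r+1}$ on highest weight vectors. -/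

section Operators

variable {k J : Type*} [Field k] [CharZero k] [NonAssocCommRing J] [Module k J]
  [IsScalarTower k J J] [SMulCommClass k J J] [IsCommJordan J]

/-- The operator by which an element of `sl₂(J)` acts on a module. -/
def op (N : Type*) [AddCommGroup N] [Module k N] [LieRingModule (SL2J k J) N]
    [LieModule k (SL2J k J) N] (x : SL2J k J) : Module.End k N := LieModule.toEnd k (SL2J k J) N x

variable {N : Type*} [AddCommGroup N] [Module k N] [LieRingModule (SL2J k J) N]
  [LieModule k (SL2J k J) N]

lemma op_apply (x : SL2J k J) (v : N) : op N x v = ⁅x, v⁆ := rfl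

lemma op_mul (x y : SL2J k J) : op N x * op N y = op N y * op N x + op N ⁅x, y⁆ := by
  ext v
  simp only [Module.End.mul_apply, LinearMap.add_apply, op_apply]
  rw [leibniz_lie x y v, add_comm]

lemma op_add (x y : SL2J k J) : op N (x + y) = op N x + op N y := map_add _ x y
lemma op_smul (r : k) (x : SL2J k J) : op N (r • x) = r • op N x := map_smul _ r x
lemma op_zero : op N (0 : SL2J k J) = 0 := map_zero _

lemma commute_op_F (a b : J) : Commute (op N (F k a)) (op N (F k b)) := by
  have := op_mul (N := N) (F k a) (F k b)
  rwa [lie_F_F, op_zero, add_zero] at this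

lemma commute_op_E (a b : J) : Commute (op N (E k a)) (op N (E k b)) := by
  have := op_mul (N := N) (E k a) (E k b)
  rwa [lie_E_E, op_zero, add_zero] at this

lemma op_E_mul_op_F {a b : J} (h : brace k a b = 0) :
    op N (E k a) * op N (F k b) = op N (F k b) * op N (E k a) + op N (H k (a * b)) := by
  have h0 : (Z 0 : SL2J k J) = 0 := rfl
  rw [op_mul, lie_E_F, h, h0, smul_zero, add_zero]

lemma op_H_mul_op_E (a b : J) :
    op N (H k a) * op N (E k b) = op N (E k b) * op N (H k a) + 2 • op N (E k (a * b)) := by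
  rw [op_mul, lie_H_E, op_smul, two_smul, two_smul]

lemma op_H_mul_op_F (a b : J) :
    op N (H k a) * op N (F k b) = op N (F k b) * op N (H k a) + 2 • -op N (F k (a * b)) := by
  rw [op_mul, lie_H_F, op_smul]
  module

variable {M : Type*} [AddCommGroup M] [Module k M] {V : JSpace k J M} {g : M →ₗ[k] N}

lemma op_H_pow_op_F (hH : ∀ (a : J) (m : M), op N (H k a) (g m) = g (V.ρ a m)) (a : J) (j N' : ℕ)
    (m : M) :
    op N (H k (jpow a j)) ((op N (F k a) ^ N') (g m)) =
      (op N (F k a) ^ N') (g (V.ρ (jpow a j) m))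
        - (2 * N') • op N (F k (jpow a (j + 1))) ((op N (F k a) ^ (N' - 1)) (g m)) := by
  have h := mul_pow_of_comm (op_H_mul_op_F (k := k) (N := N) (jpow a j) a)
    (commute_op_F (k := k) (N := N) a (jpow a j * a)).neg_right N'
  have h := LinearMap.congr_fun h (g m)
  rw [mul_comm (jpow a j) a, show a * jpow a j = jpow a (j + 1) from rfl] at h
  simp only [Module.End.mul_apply, LinearMap.add_apply, LinearMap.smul_apply, neg_mul,
    LinearMap.neg_apply, hH, smul_neg] at h
  rw [h, sub_eq_add_neg]

lemma op_E_pow_op_F (hE : ∀ (a : J) (m : M), op N (E k a) (g m) = 0)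
    (hH : ∀ (a : J) (m : M), op N (H k a) (g m) = g (V.ρ a m)) (a : J) (j N' : ℕ) (m : M) :
    op N (E k (jpow a j)) ((op N (F k a) ^ N') (g m)) =
      N' • (op N (F k a) ^ (N' - 1)) (g (V.ρ (jpow a (j + 1)) m))
        - (N' * (N' - 1)) •
          op N (F k (jpow a (j + 2))) ((op N (F k a) ^ (N' - 2)) (g m)) := by
  have hb : brace k (jpow a j) a = 0 := by simpa [jpow] using brace_jpow_jpow k a j 1
  have h1 := op_E_mul_op_F (k := k) (N := N) hb
  rw [mul_comm (jpow a j) a, show a * jpow a j = jpow a (j + 1) from rfl] at h1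
  have h2 := op_H_mul_op_F (k := k) (N := N) (jpow a (j + 1)) a
  rw [mul_comm (jpow a (j + 1)) a, show a * jpow a (j + 1) = jpow a (j + 2) from rfl] at h2
  have h := pow_mul_of_comm (x := op N (F k a)) (f := op N (E k (jpow a j)))
    (h := -op N (H k (jpow a (j + 1)))) (y := op N (F k (jpow a (j + 2))))
    (by rw [h1]; abel) (by rw [neg_mul, h2, mul_neg]; module)
    (commute_op_F (k := k) (N := N) a (jpow a (j + 2))) N'
  have h := LinearMap.congr_fun h (g m)
  simp only [Module.End.mul_apply, LinearMap.add_apply, LinearMap.smul_apply, mul_neg,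
    LinearMap.neg_apply, hH, hE, map_zero, map_neg, smul_neg] at h
  linear_combination (norm := module) -h

/-- The recursion behind `newtonSum`. Move $f(a^j)$ to the left of $e(1)^{r+1}$: the leading term
dies by `hz`, which holds in $V(M)$ for degree reasons, and the terms with $h(a^j)$ and $e(a^j)$ are
pushed through $f(a)^r$. -/
lemma pow_op_E_op_F (hE : ∀ (a : J) (m : M), op N (E k a) (g m) = 0)
    (hH : ∀ (a : J) (m : M), op N (H k a) (g m) = g (V.ρ a m))
    (hz : ∀ (a : J) (r : ℕ) m, (op N (E k (1 : J)) ^ (r + 1)) ((op N (F k a) ^ r) (g m)) = 0)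
    (a : J) (j r : ℕ) (m : M) :
    (op N (E k (1 : J)) ^ (r + 1)) (op N (F k (jpow a j)) ((op N (F k a) ^ r) (g m))) =
    (r + 1) • ((op N (E k (1 : J)) ^ r) ((op N (F k a) ^ r) (g (V.ρ (jpow a j) m)))
      - r • (op N (E k (1 : J)) ^ r) (op N (F k (jpow a (j + 1)))
      ((op N (F k a) ^ (r - 1)) (g m)))) := by
  induction r generalizing j with
  | zero =>
    have h1 := op_E_mul_op_F (k := k) (N := N) (brace_one_left k (jpow a j))
    have h1 := LinearMap.congr_fun h1 (g m)
    simp only [Module.End.mul_apply, LinearMap.add_apply, hH, hE, map_zero, one_mul,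
      zero_add] at h1
    simp [h1]
  | succ r ih =>
    have h1 := op_E_mul_op_F (k := k) (N := N) (brace_one_left k (jpow a j))
    have h2 := op_H_mul_op_E (k := k) (N := N) (jpow a j) 1
    rw [one_mul] at h1
    rw [mul_one] at h2
    have h := pow_mul_of_comm h1 h2 (commute_op_E (k := k) (N := N) _ _) (r + 2)
    have h := LinearMap.congr_fun h ((op N (F k a) ^ (r + 1)) (g m))
    have hc : op N (E k (jpow a j)) * op N (E k (1 : J)) ^ r
        = op N (E k (1 : J)) ^ r * op N (E k (jpow a j)) :=
      ((commute_op_E (k := k) (N := N) _ _).pow_right r).eq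
    have ih := ih (j + 1)
    simp only [show r + 2 - 1 = r + 1 from rfl, show r + 2 - 2 = r from rfl, hc,
      Module.End.mul_apply, LinearMap.add_apply, LinearMap.smul_apply, hz a (r + 1), map_zero,
      op_H_pow_op_F hH, op_E_pow_op_F hE hH, add_tsub_cancel_right, zero_add, map_sub, map_nsmul,
      show r + 1 - 2 = r - 1 by omega] at h
    -- The right side is also $e(1)^r e(a^j)f(a)^{r+1}m$. So the corrections from $h(a^j)$ and
    -- $e(a^j)$ are multiples of the same vector, with coefficients $-2(r+1)$ and $r+1$, and add up
    -- to $-(r+1)$.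
    have ih' : (op N (E k (1 : J)) ^ (r + 1)) (op N (F k (jpow a (j + 1)))
      ((op N (F k a) ^ r) (g m))) = (r + 1) • (op N (E k (1 : J)) ^ r)
      ((op N (F k a) ^ r) (g (V.ρ (jpow a (j + 1)) m)))
      - ((r + 1) * r) • (op N (E k (1 : J)) ^ r) (op N (F k (jpow a (j + 2)))
      ((op N (F k a) ^ (r - 1)) (g m))) := by
      rw [ih, smul_sub, smul_smul]
    rw [show r + 1 + 1 = r + 2 from rfl, h, ← ih', add_tsub_cancel_right]
    module

/-- The action of `e(1)^(r+1) f(a)^(r+1)` on vectors killed by all `e(b)`. -/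
lemma pow_op_E_pow_op_F (hE : ∀ (a : J) (m : M), op N (E k a) (g m) = 0)
    (hH : ∀ (a : J) (m : M), op N (H k a) (g m) = g (V.ρ a m))
    (hz : ∀ (a : J) (r : ℕ) m, (op N (E k (1 : J)) ^ (r + 1)) ((op N (F k a) ^ r) (g m)) = 0)
    (a : J) (r : ℕ) :
    (∀ m, (op N (E k (1 : J)) ^ (r + 1)) ((op N (F k a) ^ (r + 1)) (g m)) =
      (r + 1).factorial • g (newtonSum (fun i => V.ρ (jpow a i)) r 1 m)) ∧
    ∀ j m, (op N (E k (1 : J)) ^ (r + 1)) (op N (F k (jpow a j)) ((op N (F k a) ^ r) (g m))) =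
      (r + 1).factorial • g (newtonSum (fun i => V.ρ (jpow a i)) r j m) := by
  have of_snd : ∀ r, (∀ j m, (op N (E k (1 : J)) ^ (r + 1)) (op N (F k (jpow a j))
      ((op N (F k a) ^ r) (g m))) =
      (r + 1).factorial • g (newtonSum (fun i => V.ρ (jpow a i)) r j m)) →
      ∀ m, (op N (E k (1 : J)) ^ (r + 1)) ((op N (F k a) ^ (r + 1)) (g m)) =
      (r + 1).factorial • g (newtonSum (fun i => V.ρ (jpow a i)) r 1 m) := by
    intro r h m
    rw [← h 1 m, show jpow a 1 = a from mul_one a, pow_succ' (op N (F k a)), Module.End.mul_apply]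
  induction r with
  | zero =>
    have key : ∀ j m, (op N (E k (1 : J)) ^ (0 + 1)) (op N (F k (jpow a j))
      ((op N (F k a) ^ 0) (g m))) =
      (0 + 1).factorial • g (newtonSum (fun i => V.ρ (jpow a i)) 0 j m) := by
      intro j m
      rw [pow_op_E_op_F hE hH hz]
      simp [newtonSum]
    exact ⟨of_snd 0 key, key⟩
  | succ r ih =>
    have key : ∀ j m, (op N (E k (1 : J)) ^ (r + 1 + 1)) (op N (F k (jpow a j))
      ((op N (F k a) ^ (r + 1)) (g m))) =
      (r + 1 + 1).factorial • g (newtonSum (fun i => V.ρ (jpow a i)) (r + 1) j m) := by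
      intro j m
      rw [pow_op_E_op_F hE hH hz, ih.1, add_tsub_cancel_right, ih.2, Nat.factorial_succ (r + 1),
        newtonSum]
      simp only [LinearMap.sub_apply, Module.End.mul_apply, LinearMap.smul_apply, map_sub,
        map_nsmul]
      module
    exact ⟨of_snd (r + 1) key, key⟩

end Operators

namespace JSpace

variable {k J M : Type*} [Field k] [NonAssocCommRing J] [Module k J]
  [IsScalarTower k J J] [SMulCommClass k J J] [AddCommGroup M] [Module k M]
  [CharZero k] [IsCommJordan J] {V : JSpace k J M}

lemma pow_op_F_mem (a : J) (N : ℕ) {r : ℕ} {v : V.Verma} (hv : v ∈ V.degPiece r) :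
    (op V.Verma (F k a) ^ N) v ∈ V.degPiece (r + N) := by
  induction N with
  | zero => exact hv
  | succ N ih => rw [pow_succ', Module.End.mul_apply]; exact lie_F_mem ih a

lemma pow_op_E_eq_zero (a : J) {r : ℕ} {v : V.Verma} (hv : v ∈ V.degPiece r) :
    (op V.Verma (E k a) ^ (r + 1)) v = 0 := by
  induction r generalizing v with
  | zero => rw [zero_add, pow_one]; exact lie_E_eq_zero hv a
  | succ r ih => rw [pow_succ, Module.End.mul_apply]; exact ih (lie_E_mem hv a)

lemma op_H_toVerma (a : J) (m : M) : op V.Verma (H k a) (V.toVerma m) = V.toVerma (V.ρ a m) := by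
  rw [op_apply, lie_toVerma _ _ rfl]
  simp [leviAction_apply, H]

lemma op_E_toVerma (a : J) (m : M) : op V.Verma (E k a) (V.toVerma m) = 0 :=
  lie_E_eq_zero (toVerma_mem m) a

lemma pow_op_E_pow_op_F_toVerma (a : J) (r : ℕ) (m : M) :
    (op V.Verma (E k (1 : J)) ^ (r + 1)) ((op V.Verma (F k a) ^ (r + 1)) (V.toVerma m)) =
      (r + 1).factorial • V.toVerma (newtonSum (fun i => V.ρ (jpow a i)) r 1 m) :=
  (pow_op_E_pow_op_F op_E_toVerma op_H_toVerma (fun a r m => by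
    have := pow_op_F_mem a r (toVerma_mem (V := V) m)
    rw [zero_add] at this
    exact pow_op_E_eq_zero 1 this) a r).1 m

end JSpace

/-! ### Conjugacy class sizes and Newton's identities. -/

/-- The order of the centralizer of a permutation whose cycle lengths are the elements of `s`. -/
def centralizerOrder (s : Multiset ℕ) : ℕ := s.prod * ∏ i ∈ s.toFinset, (s.count i).factorial

open Finset in
lemma card_conjClass_mul {N : ℕ} (σ : N.Partition) :
    (conjClass σ).card * centralizerOrder σ.parts = N.factorial := by
  -- `Equiv.Perm.cycleType` omits fixed points; the parts equal to $1$ reappear as `N - m.sum`.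
  set m := σ.parts.filter (2 ≤ ·) with hm
  have hparts : σ.parts = m + Multiset.replicate (σ.parts.count 1) 1 := by
    conv_lhs => rw [← Multiset.filter_add_not (2 ≤ ·) σ.parts]
    congr 1
    rw [← Multiset.filter_eq']
    refine Multiset.filter_congr fun i hi => ?_
    have := σ.parts_pos hi
    omega
  have hsum : m.sum + σ.parts.count 1 = N := by
    have h := congrArg Multiset.sum hparts
    rw [σ.parts_sum] at h
    simpa using h.symm
  have h1 : m.count 1 = 0 := by simp [hm, Multiset.count_filter]
  have hclass : conjClass σ = ({g | g.cycleType = m} : Finset (Equiv.Perm (Fin N))) := by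
    ext g
    simp only [conjClass, mem_filter, mem_univ, true_and]
    constructor
    · intro h
      rw [hm, ← h, Equiv.Perm.filter_parts_partition_eq_cycleType]
    · intro h
      rw [Equiv.Perm.parts_partition, h, hparts, ← Equiv.Perm.sum_cycleType, h, Fintype.card_fin]
      congr 2
      omega
  have hcard := Equiv.Perm.card_of_cycleType_mul_eq (Fin N) m
  rw [if_pos ⟨by rw [Fintype.card_fin]; omega, fun a ha => (Multiset.mem_filter.1 ha).2⟩,
    Fintype.card_fin] at hcard
  rw [hclass, ← hcard, centralizerOrder]
  congr 1
  have hprod : σ.parts.prod = m.prod := by rw [hparts]; simp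
  have hcount : ∏ i ∈ σ.parts.toFinset, (σ.parts.count i).factorial
      = (σ.parts.count 1).factorial * ∏ i ∈ m.toFinset, (m.count i).factorial := by
    have hne : 1 ∉ m.toFinset := by
      rw [Multiset.mem_toFinset, ← Multiset.count_eq_zero]; exact h1
    have hsub : σ.parts.toFinset ⊆ insert 1 m.toFinset := by
      intro i hi
      rw [Multiset.mem_toFinset] at hi
      rw [mem_insert, Multiset.mem_toFinset, hm, Multiset.mem_filter]
      have := σ.parts_pos hi
      by_cases h : i = 1
      · exact Or.inl h
      · exact Or.inr ⟨hi, by omega⟩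
    rw [prod_subset hsub (fun i _ hi => by
      rw [Multiset.mem_toFinset, ← Multiset.count_eq_zero] at hi
      rw [hi, Nat.factorial_zero]), prod_insert hne]
    congr 1
    refine prod_congr rfl fun i hi => ?_
    rw [Multiset.mem_toFinset, hm, Multiset.mem_filter] at hi
    rw [hm, Multiset.count_filter, if_pos hi.2]
  rw [hprod, hcount, show N - m.sum = σ.parts.count 1 by omega]
  ring

lemma centralizerOrder_cons (i : ℕ) (s : Multiset ℕ) :
    centralizerOrder (i ::ₘ s) = i * (s.count i + 1) * centralizerOrder s := by
  have h : ∀ t : Multiset ℕ, t.toFinset ⊆ insert i s.toFinset →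
      ∏ j ∈ t.toFinset, (t.count j).factorial
        = ∏ j ∈ insert i s.toFinset, (t.count j).factorial := fun t ht =>
    Finset.prod_subset ht fun j _ hj => by
      rw [Multiset.mem_toFinset, ← Multiset.count_eq_zero] at hj
      rw [hj, Nat.factorial_zero]
  rw [centralizerOrder, centralizerOrder, h s (Finset.subset_insert _ _),
    h (i ::ₘ s) (by rw [Multiset.toFinset_cons]), Multiset.prod_cons,
    ← Finset.mul_prod_erase _ _ (Finset.mem_insert_self i _),
    ← Finset.mul_prod_erase _ _ (Finset.mem_insert_self i _), Multiset.count_cons_self,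
    Nat.factorial_succ]
  have : ∀ j ∈ (insert i s.toFinset).erase i, ((i ::ₘ s).count j).factorial
      = (s.count j).factorial := fun j hj => by
    rw [Multiset.count_cons_of_ne (Finset.ne_of_mem_erase hj)]
  rw [Finset.prod_congr rfl this]
  ring

lemma centralizerOrder_pos {s : Multiset ℕ} (hs : ∀ i ∈ s, 0 < i) : 0 < centralizerOrder s :=
  Nat.mul_pos (Multiset.prod_pos hs) (Finset.prod_pos fun _ _ => Nat.factorial_pos _)

section Newton

variable {k A : Type*} [Field k] [CharZero k] [CommRing A] [Algebra k A] (p : ℕ → A)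

variable (k) in
/-- The contribution of a cycle type to the elementary symmetric function, in terms of the power
sums. -/
def cycleTerm (s : Multiset ℕ) : A :=
  ((centralizerOrder s : k)⁻¹ * (s.map fun i => -(-1 : k) ^ i).prod) • (s.map p).prod

/-- Adding a part $i$ multiplies the centralizer order by $i$ times the new multiplicity of $i$,
exactly the factor on the left. -/
lemma cycleTerm_cons {i : ℕ} (hi : 0 < i) {s : Multiset ℕ} (hs : ∀ i ∈ s, 0 < i) :
    ((i * (i ::ₘ s).count i : ℕ) : k) • cycleTerm k p (i ::ₘ s)
      = (-(-1 : k) ^ i) • (p i * cycleTerm k p s) := by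
  have h0 : (centralizerOrder s : k) ≠ 0 := Nat.cast_ne_zero.2 (centralizerOrder_pos hs).ne'
  have h1 : (i : k) ≠ 0 := Nat.cast_ne_zero.2 hi.ne'
  have h2 : (s.count i : k) + 1 ≠ 0 := Nat.cast_add_one_ne_zero _
  rw [cycleTerm, cycleTerm, centralizerOrder_cons, Multiset.map_cons, Multiset.map_cons,
    Multiset.prod_cons, Multiset.prod_cons, mul_smul_comm, smul_smul, smul_smul,
    Multiset.count_cons_self]
  congr 1
  push_cast
  field_simp

variable (k) in
/-- The elementary symmetric function in terms of the power sums, as a sum over cycle types. -/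
def esymmSum (N : ℕ) : A := ∑ σ : N.Partition, cycleTerm k p σ.parts

lemma esymmSum_zero : esymmSum k p 0 = 1 := by
  rw [esymmSum, Fintype.sum_unique]
  simp [cycleTerm, centralizerOrder, Nat.Partition.indiscrete]

lemma sum_count_mul {N : ℕ} (σ : N.Partition) : ∑ i ∈ σ.parts.toFinset, i * σ.parts.count i = N := by
  conv_rhs => rw [← σ.parts_sum]
  rw [Finset.sum_multiset_count]
  exact Finset.sum_congr rfl fun i _ => by rw [smul_eq_mul, mul_comm]

/-- Newton's identities. -/
lemma esymmSum_newton (N : ℕ) : (N : k) • esymmSum k p N =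
    ∑ i ∈ Finset.Icc 1 N, (-(-1 : k) ^ i) • (p i * esymmSum k p (N - i)) := by
  have h1 : (N : k) • esymmSum k p N = ∑ σ : N.Partition, ∑ i ∈ σ.parts.toFinset,
      (-(-1 : k) ^ i) • (p i * cycleTerm k p (σ.parts.erase i)) := by
    rw [esymmSum, Finset.smul_sum]
    refine Finset.sum_congr rfl fun σ _ => ?_
    -- Writing $N$ as the sum of $i$ times the multiplicity of $i$ lets each summand absorb the
    -- removal of one part $i$.
    have hN : (N : k) = ∑ i ∈ σ.parts.toFinset, ((i * σ.parts.count i : ℕ) : k) := by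
      rw [← Nat.cast_sum, sum_count_mul σ]
    rw [hN, Finset.sum_smul]
    refine Finset.sum_congr rfl fun i hi => ?_
    rw [Multiset.mem_toFinset] at hi
    rw [← cycleTerm_cons p (σ.parts_pos hi)
      (fun j hj => σ.parts_pos (Multiset.mem_of_mem_erase hj)), Multiset.cons_erase hi]
  have h2 : ∀ i, (-(-1 : k) ^ i) • (p i * esymmSum k p (N - i))
      = ∑ τ : (N - i).Partition, (-(-1 : k) ^ i) • (p i * cycleTerm k p τ.parts) := by
    intro i
    rw [esymmSum, Finset.mul_sum, Finset.smul_sum]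
  simp only [h1, h2]
  rw [Finset.sum_sigma', Finset.sum_sigma']
  -- Partitions of $N$ with a chosen part size $i$ correspond to pairs of $i$ and a partition of
  -- $N-i$.
  let f : ∀ x ∈ (Finset.Icc 1 N).sigma fun i => (Finset.univ : Finset (N - i).Partition),
      (_ : N.Partition) × ℕ := fun x hx => ⟨⟨x.1 ::ₘ x.2.parts, fun {j} hj => by
        rw [Finset.mem_sigma, Finset.mem_Icc] at hx
        rcases Multiset.mem_cons.1 hj with rfl | hj
        · exact hx.1.1
        · exact x.2.parts_pos hj, by
        rw [Finset.mem_sigma, Finset.mem_Icc] at hx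
        rw [Multiset.sum_cons, x.2.parts_sum]
        omega⟩, x.1⟩
  refine (Finset.sum_bij f ?_ ?_ ?_ ?_).symm
  · intro x hx
    simp [f]
  · rintro ⟨i, τ⟩ hx ⟨i', τ'⟩ hx' h
    simp only [f, Sigma.mk.injEq, Nat.Partition.mk.injEq] at h
    obtain ⟨h, h'⟩ := h
    obtain rfl : i = i' := by simpa using h'
    rw [Multiset.cons_inj_right] at h
    rw [Nat.Partition.ext h]
  · rintro ⟨σ, i⟩ hx
    rw [Finset.mem_sigma, Multiset.mem_toFinset] at hx
    have hi : i ∈ σ.parts := hx.2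
    have hle : i ≤ N := by rw [← σ.parts_sum]; exact Multiset.le_sum_of_mem hi
    refine ⟨⟨i, ⟨σ.parts.erase i, fun hj => σ.parts_pos (Multiset.mem_of_mem_erase hj), ?_⟩⟩,
      ?_, ?_⟩
    · have := congrArg Multiset.sum (Multiset.cons_erase hi)
      rw [Multiset.sum_cons, σ.parts_sum] at this
      omega
    · simp only [Finset.mem_sigma, Finset.mem_Icc, Finset.mem_univ, and_true]
      exact ⟨σ.parts_pos hi, hle⟩
    · simp [f, Multiset.cons_erase hi]
  · intro x hx
    simp [f]

lemma newtonSum_eq (N : ℕ) : (∀ j, newtonSum p N j = (N.factorial : k) •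
      ∑ i ∈ Finset.range (N + 1), (-1 : k) ^ i • (p (j + i) * esymmSum k p (N - i))) ∧
    newtonSum p N 1 = ((N + 1).factorial : k) • esymmSum k p (N + 1) := by
  -- At $j=1$ the alternating sum is, after an index shift, the right side of Newton's identity for
  -- $N+1$; this turns $N!$ into $(N+1)!$.
  have of_fst : ∀ N, (∀ j, newtonSum p N j = (N.factorial : k) •
      ∑ i ∈ Finset.range (N + 1), (-1 : k) ^ i • (p (j + i) * esymmSum k p (N - i))) →
      newtonSum p N 1 = ((N + 1).factorial : k) • esymmSum k p (N + 1) := by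
    intro N h
    rw [h, Nat.factorial_succ, mul_comm, Nat.cast_mul, mul_smul, esymmSum_newton,
      Finset.range_eq_Ico, Finset.sum_Ico_eq_sum_range, ← Finset.Ico_add_one_right_eq_Icc,
      Finset.sum_Ico_eq_sum_range]
    congr 1
    refine Finset.sum_congr (by simp) fun i _ => ?_
    rw [show N + 1 - (1 + i) = N - i by omega]
    simp [pow_add]
  induction N with
  | zero =>
    have h : ∀ j, newtonSum p 0 j = ((Nat.factorial 0 : ℕ) : k) •
      ∑ i ∈ Finset.range (0 + 1), (-1 : k) ^ i • (p (j + i) * esymmSum k p (0 - i)) := by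
      intro j
      simp [newtonSum, esymmSum_zero]
    exact ⟨h, of_fst 0 h⟩
  | succ N ih =>
    have h : ∀ j, newtonSum p (N + 1) j = ((Nat.factorial (N + 1) : ℕ) : k) •
      ∑ i ∈ Finset.range (N + 1 + 1), (-1 : k) ^ i • (p (j + i) * esymmSum k p (N + 1 - i)) := by
      intro j
      have hs : ∑ i ∈ Finset.range (N + 1),
          (-1 : k) ^ (i + 1) • (p (j + (i + 1)) * esymmSum k p (N + 1 - (i + 1)))
          = -∑ i ∈ Finset.range (N + 1), (-1 : k) ^ i • (p (j + 1 + i) * esymmSum k p (N - i)) := by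
        rw [← Finset.sum_neg_distrib]
        refine Finset.sum_congr rfl fun i _ => ?_
        rw [show N + 1 - (i + 1) = N - i by omega, show j + 1 + i = j + (i + 1) by ring, pow_succ]
        simp
      rw [newtonSum, ih.2, ih.1 (j + 1), Finset.sum_range_succ' _ (N + 1), hs,
        Nat.factorial_succ, mul_comm (p _) (esymmSum k p _), pow_zero, one_smul, add_zero,
        tsub_zero, smul_mul_assoc]
      push_cast
      module
    exact ⟨h, of_fst (N + 1) h⟩

variable (k) in
include k in
lemma sum_conjClass_eq_newtonSum (N : ℕ) :
    ∑ σ : (N + 1).Partition, (signPartition σ * ((conjClass σ).card : ℤ)) • (σ.parts.map p).prod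
      = newtonSum p N 1 := by
  rw [(newtonSum_eq (k := k) p N).2, esymmSum, Finset.smul_sum]
  refine Finset.sum_congr rfl fun σ _ => ?_
  have h0 : (centralizerOrder σ.parts : k) ≠ 0 :=
    Nat.cast_ne_zero.2 (centralizerOrder_pos fun i hi => σ.parts_pos hi).ne'
  rw [cycleTerm, smul_smul, ← card_conjClass_mul σ, ← Int.cast_smul_eq_zsmul k]
  congr 1
  have : ((signPartition σ : ℤ) : k) = (σ.parts.map fun i => -(-1 : k) ^ i).prod := by
    rw [signPartition, Int.cast_multiset_prod, Multiset.map_map]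
    simp
  push_cast
  rw [this]
  field_simp

end Newton

namespace JSpace

variable {k J M : Type*} [Field k] [NonAssocCommRing J] [Module k J]
  [IsScalarTower k J J] [SMulCommClass k J J] [AddCommGroup M] [Module k M]
  [CharZero k] [IsCommJordan J] (V : JSpace k J M)

lemma sum_conjClass_smul_ρPartition (a : J) (n : ℕ) :
    ∑ σ : (n + 1).Partition, (signPartition σ * ((conjClass σ).card : ℤ)) • V.ρPartition σ a
      = newtonSum (fun i => V.ρ (jpow a i)) n 1 := by
  let S : Set (Module.End k M) := Set.range fun i => V.ρ (jpow a i)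
  have hS : ∀ x ∈ S, ∀ y ∈ S, x * y = y * x := by
    rintro _ ⟨i, rfl⟩ _ ⟨j, rfl⟩
    exact (V.commute_ρ_jpow a i j).eq
  -- The $\rho(a^i)$ commute, so the identity can be proved in the commutative subalgebra they
  -- generate, where the order of factors is irrelevant.
  let _ : CommRing (Algebra.adjoin k S) :=
    { (inferInstance : Ring (Algebra.adjoin k S)) with
      mul_comm := (Algebra.isMulCommutative_adjoin k hS).is_comm.comm }
  let p : ℕ → Algebra.adjoin k S := fun i => ⟨V.ρ (jpow a i), Algebra.subset_adjoin ⟨i, rfl⟩⟩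
  have h := congrArg (Algebra.adjoin k S).val (sum_conjClass_eq_newtonSum k p n)
  have hnewton : ∀ r j, (Algebra.adjoin k S).val (newtonSum p r j)
      = newtonSum (fun i => V.ρ (jpow a i)) r j := by
    intro r
    induction r with
    | zero => intro j; rfl
    | succ r ih =>
      intro j
      rw [newtonSum, newtonSum, map_sub, map_mul, map_nsmul, ih, ih]
      rfl
  rw [map_sum] at h
  replace h := h.trans (hnewton n 1)
  rw [← h]
  refine Finset.sum_congr rfl fun σ _ => ?_
  rw [map_zsmul]
  congr 1
  conv_rhs => rw [← Multiset.sort_eq σ.parts (· ≥ ·)]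
  rw [Multiset.map_coe, Multiset.prod_coe, map_list_prod, List.map_map]
  rfl

end JSpace

/-! ### Polarization of $f(a)^{n+1}$ and of $e(1)^{n+1}$. -/

section Polarization

variable {k : Type*} [Field k] [CharZero k]

/-- The coefficients of a polynomial function with values in a vector space are unique. -/
lemma eq_zero_of_sum_pow_smul_eq_zero {N : Type*} [AddCommGroup N] [Module k N] (w : ℕ → N) (d : ℕ)
    (h : ∀ t : k, ∑ i ∈ Finset.range d, t ^ i • w i = 0) {i : ℕ} (hi : i < d) : w i = 0 := by
  refine (Module.forall_dual_apply_eq_zero_iff k _).1 fun φ => ?_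
  have hP : (∑ i ∈ Finset.range d, Polynomial.monomial i (φ (w i)) : Polynomial k) = 0 := by
    refine Polynomial.funext fun t => ?_
    have ht := congrArg φ (h t)
    rw [map_sum, map_zero] at ht
    rw [Polynomial.eval_finsetSum, Polynomial.eval_zero, ← ht]
    refine Finset.sum_congr rfl fun i _ => ?_
    rw [Polynomial.eval_monomial, map_smul, smul_eq_mul, mul_comm]
  have hc := congrArg (fun P => Polynomial.coeff P i) hP
  simp only [Polynomial.finsetSum_coeff, Polynomial.coeff_monomial, Polynomial.coeff_zero] at hc
  rwa [Finset.sum_ite_eq', if_pos (Finset.mem_range.2 hi)] at hc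

variable {J : Type*} [NonAssocCommRing J] [Module k J]
  [IsScalarTower k J J] [SMulCommClass k J J] [IsCommJordan J]
  {N : Type*} [AddCommGroup N] [Module k N] [LieRingModule (SL2J k J) N] [LieModule k (SL2J k J) N]

/-- Polarization of the powers of `f(a)`. -/
lemma polarize_pow_op_F {N' : Type*} [AddCommGroup N'] [Module k N'] (T : N →ₗ[k] N') (s : ℕ)
    (v : N) (h : ∀ a : J, T ((op N (F k a) ^ (s + 1)) v) = 0) (a c : J) :
    T (op N (F k c) ((op N (F k a) ^ s) v)) = 0 := by
  have key : ∀ t : k, ∑ i ∈ Finset.range (s + 1 + 1), t ^ i • (((s + 1).choose i : k) •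
      T ((op N (F k c) ^ i) ((op N (F k a) ^ (s + 1 - i)) v))) = 0 := by
    intro t
    have h1 := h (t • c + a)
    have hc : Commute (t • op N (F k c)) (op N (F k a)) := (commute_op_F c a).smul_left t
    rw [F_add, F_smul, op_add, op_smul, hc.add_pow, LinearMap.sum_apply, map_sum] at h1
    rw [← h1]
    refine Finset.sum_congr rfl fun i _ => ?_
    rw [← nsmul_eq_mul', smul_pow, smul_mul_assoc, LinearMap.smul_apply, LinearMap.smul_apply,
      map_nsmul, map_smul, Module.End.mul_apply, ← Nat.cast_smul_eq_nsmul k, smul_comm]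
  -- The coefficient of $t$ in $f(a+tc)^{s+1}$ is $(s+1)f(c)f(a)^s$.
  have := eq_zero_of_sum_pow_smul_eq_zero _ _ key (i := 1) (by omega)
  rw [smul_eq_zero, pow_one, add_tsub_cancel_right] at this
  exact this.resolve_left (Nat.cast_ne_zero.2 (by simp))

variable (k J N) in
/-- The space of the operators `e(a)`. -/
def raising : Submodule k (Module.End k N) :=
  LinearMap.range
    { toFun := fun a : J => op N (E k a)
      map_add' := fun a b => by rw [E_add, op_add]
      map_smul' := fun r a => by rw [E_smul, op_smul]; rfl : J →ₗ[k] Module.End k N }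

lemma op_E_mem_raising (a : J) : op N (E k a) ∈ raising k J N := ⟨a, rfl⟩

/-- The commutator with $h(b)$ is a derivation, and $[h(b),e(c)]=2e(bc)$ stays in $\mathfrak G_1$.
-/
lemma op_H_commutator_mem (b : J) (j : ℕ) (T : Module.End k N) (hT : T ∈ raising k J N ^ j) :
    op N (H k b) * T - T * op N (H k b) ∈ raising k J N ^ j := by
  induction j generalizing T with
  | zero =>
    rw [pow_zero] at hT ⊢
    obtain ⟨r, rfl⟩ := Submodule.mem_one.1 hT
    rw [(Algebra.commutes r (op N (H k b))), sub_self]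
    exact zero_mem _
  | succ j ih =>
    rw [pow_succ] at hT ⊢
    refine Submodule.mul_induction_on hT ?_ ?_
    · rintro T hT _ ⟨c, rfl⟩
      have h := op_H_mul_op_E (k := k) (N := N) b c
      have e : op N (H k b) * (T * op N (E k c)) - T * op N (E k c) * op N (H k b)
          = (op N (H k b) * T - T * op N (H k b)) * op N (E k c)
            + T * (2 • op N (E k (b * c))) := by
        rw [mul_assoc T, ← sub_eq_iff_eq_add'.2 h]
        noncomm_ring
      change op N (H k b) * (T * op N (E k c)) - T * op N (E k c) * op N (H k b) ∈ _
      rw [e]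
      exact add_mem (Submodule.mul_mem_mul (ih T hT) (op_E_mem_raising c))
        (Submodule.mul_mem_mul hT (nsmul_mem (op_E_mem_raising _) 2))
    · intro S T hS hT
      rw [mul_add, add_mul, add_sub_add_comm]
      exact add_mem hS hT

/-- If `e(1)^r` kills a subspace stable under all `h(b)`, then so do all `e(b₁) ⋯ e(bᵣ)`. -/
lemma raising_pow_apply_eq_zero (W : Submodule k N)
    (hW : ∀ (b : J), ∀ v ∈ W, op N (H k b) v ∈ W) (j s : ℕ)
    (h : ∀ v ∈ W, (op N (E k (1 : J)) ^ (j + s)) v = 0) :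
    ∀ T ∈ raising k J N ^ j, ∀ v ∈ W, T ((op N (E k (1 : J)) ^ s) v) = 0 := by
  induction j generalizing s with
  | zero =>
    intro T hT v hv
    rw [pow_zero] at hT
    obtain ⟨r, rfl⟩ := Submodule.mem_one.1 hT
    rw [zero_add] at h
    rw [h v hv, map_zero]
  | succ j ih =>
    have ih := ih (s + 1) (by rwa [add_assoc, add_comm 1 s] at h)
    intro T hT v hv
    rw [pow_succ] at hT
    refine Submodule.mul_induction_on (C := fun T => T ((op N (E k (1 : J)) ^ s) v) = 0) hT ?_ ?_
    · rintro T hT _ ⟨b, rfl⟩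
      -- Apply $[h(b),T]$ to $e(1)^{s+1}v$: all terms vanish by induction except $2(s+1)\,T
      -- e(b)e(1)^s v$, so one $e(1)$ has been traded for $e(b)$.
      have h1 := ih _ (op_H_commutator_mem b j T hT) v hv
      have h2 := op_H_mul_op_E (k := k) (N := N) b 1
      rw [mul_one] at h2
      have h3 := LinearMap.congr_fun
        (mul_pow_of_comm h2 (commute_op_E (k := k) (N := N) 1 b) (s + 1)) v
      rw [LinearMap.sub_apply, Module.End.mul_apply, Module.End.mul_apply, ih T hT v hv, map_zero,
        zero_sub, neg_eq_zero] at h1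
      rw [Module.End.mul_apply, LinearMap.add_apply, Module.End.mul_apply, LinearMap.smul_apply,
        Module.End.mul_apply, add_tsub_cancel_right] at h3
      rw [h3, map_add, ih T hT _ (hW b v hv), zero_add, map_nsmul, ← Nat.cast_smul_eq_nsmul k,
        smul_eq_zero] at h1
      exact h1.resolve_left (Nat.cast_ne_zero.2 (by simp))
    · intro S T hS hT
      rw [LinearMap.add_apply, hS, hT, add_zero]

end Polarization

/-! ### The kernel of the map to the coinduced module, and the equivalences. -/

namespace JSpace

variable {k J M : Type*} [Field k] [NonAssocCommRing J] [Module k J]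
  [IsScalarTower k J J] [SMulCommClass k J J] [AddCommGroup M] [Module k M]
  [CharZero k] [IsCommJordan J] {V : JSpace k J M}

/-- Repeated polarization. The map $T$ is arbitrary so that each polarized factor $f(c)$ can be
absorbed into it. -/
lemma apply_degPiece_eq_zero {N' : Type*} [AddCommGroup N'] [Module k N'] (r : ℕ)
    (T : V.Verma →ₗ[k] N')
    (h : ∀ (a : J) (m : M), T ((op V.Verma (F k a) ^ r) (V.toVerma m)) = 0) {v : V.Verma}
    (hv : v ∈ V.degPiece r) : T v = 0 := by
  induction r generalizing T v with
  | zero =>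
    obtain ⟨m, rfl⟩ := hv
    exact h 0 m
  | succ r ih =>
    refine degPiece_induction (p := fun v => T v = 0) hv (fun c v hv => ?_) (map_zero T)
      (fun v w hv hw => by rw [map_add, hv, hw, add_zero])
      (fun c v hv => by rw [map_smul, hv, smul_zero])
    exact ih (T ∘ₗ op V.Verma (F k c))
      (fun a m => polarize_pow_op_F T r (V.toVerma m) (fun a => h a m) a c) hv

/-- Each $e(a)$ lowers the degree by one, and only degree $0$ has a nonzero value at the empty list.
-/
lemma eval_vermaToCoinduced_eq_zero {s : ℕ} {v : V.Verma} (hv : v ∈ V.degPiece s) (L : List J)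
    (hL : L.length ≠ s) : (V.vermaToCoinduced v).eval L = 0 := by
  induction L generalizing s v with
  | nil =>
    cases s with
    | zero => exact absurd rfl hL
    | succ s =>
      refine degPiece_induction (p := fun v => (V.vermaToCoinduced v).eval [] = 0) hv
        (fun c v hv => ?_) (by rw [map_zero]; rfl) (fun v w hv hw => ?_) (fun c v hv => ?_)
      · rw [LieModuleHom.map_lie, Coinduced.eval_lie, coact_nil]
        have h0 : ((F k c : SL2J k J)).e = 0 := rfl
        have h1 := (V.vermaToCoinduced v).2.2.1 [] [] (0 : k) 0
        rw [zero_smul, zero_smul] at h1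
        rw [h0, show (V.vermaToCoinduced v).eval [0] = 0 from h1]
        simp [leviAction_apply, F]
      · rw [map_add]
        exact (congrArg₂ (· + ·) hv hw).trans (add_zero _)
      · rw [map_smul]
        exact (congrArg (c • ·) hv).trans (smul_zero c)
  | cons a L ih =>
    rw [Coinduced.eval_cons, ← LieModuleHom.map_lie]
    cases s with
    | zero => rw [lie_E_eq_zero hv, map_zero]; rfl
    | succ s => exact ih (lie_E_mem hv a) fun h => hL (by rw [List.length_cons, h])

lemma eval_vermaToCoinduced_of_raising (L : List J) (v : V.Verma)
    (h : ∀ T ∈ raising k J V.Verma ^ L.length, T v = 0) : (V.vermaToCoinduced v).eval L = 0 := by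
  induction L generalizing v with
  | nil =>
    have : v = 0 := h 1 (by rw [List.length_nil, pow_zero]; exact Submodule.one_le.1 le_rfl)
    rw [this, map_zero]; rfl
  | cons a L ih =>
    rw [Coinduced.eval_cons, ← LieModuleHom.map_lie]
    refine ih _ fun T hT => ?_
    refine h (T * op V.Verma (E k a)) ?_
    rw [List.length_cons, pow_succ]
    exact Submodule.mul_mem_mul hT (op_E_mem_raising a)

/-- In degree $n+1$ only lists of length $n+1$ matter, and there all products of $n+1$ raising
operators vanish. Higher degrees follow because the kernel is a submodule. -/
lemma vermaToCoinduced_eq_zero {n : ℕ}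
    (h : ∀ (a : J) (m : M), (op V.Verma (E k (1 : J)) ^ (n + 1))
      ((op V.Verma (F k a) ^ (n + 1)) (V.toVerma m)) = 0) (r : ℕ) (hr : n < r) :
    ∀ v ∈ V.degPiece r, V.vermaToCoinduced v = 0 := by
  induction r, hr using Nat.le_induction with
  | base =>
    intro v hv
    ext L
    rw [Coinduced.eval_zero]
    by_cases hL : L.length = n + 1
    · refine eval_vermaToCoinduced_of_raising L v fun T hT => ?_
      rw [hL] at hT
      exact raising_pow_apply_eq_zero (V.degPiece (n + 1)) (fun b v hv => lie_H_mem hv b) (n + 1) 0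
        (fun v hv => apply_degPiece_eq_zero (n + 1) (op V.Verma (E k (1 : J)) ^ (n + 1)) h hv)
        T hT v hv
    · exact eval_vermaToCoinduced_eq_zero hv L hL
  | succ r _ ih =>
    intro v hv
    refine degPiece_induction (p := fun v => V.vermaToCoinduced v = 0) hv (fun c v hv => ?_)
      (map_zero _) (fun v w hv hw => by rw [map_add, hv, hw, add_zero])
      (fun c v hv => by rw [map_smul, hv, smul_zero])
    rw [LieModuleHom.map_lie, ih v hv, lie_zero]

lemma pow_ι_smul (x : SL2J k J) (r : ℕ) (v : V.Verma) :
    UniversalEnvelopingAlgebra.ι k x ^ r • v = (op V.Verma x ^ r) v := by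
  induction r generalizing v with
  | zero => rw [pow_zero, pow_zero, one_smul, Module.End.one_apply]
  | succ r ih =>
    rw [pow_succ, pow_succ, mul_smul, ih, Module.End.mul_apply]
    rfl

lemma pow_op_mem (X : LieSubmodule k (SL2J k J) V.Verma) (x : SL2J k J) (r : ℕ) {v : V.Verma}
    (hv : v ∈ X) : (op V.Verma x ^ r) v ∈ X := by
  induction r with
  | zero => exact hv
  | succ r ih => rw [pow_succ', Module.End.mul_apply]; exact X.lie_mem ih

/-- The vector $f(a)^{n+1}m$ has weight $-n-2$ and so lies in $X$; applying $e(1)^{n+1}$ gives an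
element of $M\cap X=0$. -/
lemma newtonSum_ρ_eq_zero_of_hasBoundedQuotient {n : ℕ} (hn : V.IsOfLevel n)
    (h : V.HasBoundedQuotient n) (a : J) : newtonSum (fun i => V.ρ (jpow a i)) n 1 = 0 := by
  obtain ⟨X, hX, hinj⟩ := h
  ext m
  have hmem : (op V.Verma (F k a) ^ (n + 1)) (V.toVerma m) ∈ V.degPiece (0 + (n + 1)) :=
    pow_op_F_mem a (n + 1) (toVerma_mem m)
  have hw := map_mem_weightSpace (LieSubmodule.Quotient.mk' X) (degPiece_le_weightSpace hn _ hmem)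
  rw [hX.weightSpace_eq_bot (by simp; omega), Submodule.mem_bot,
    LieSubmodule.Quotient.mk_eq_zero] at hw
  have h1 := pow_op_mem X (E k (1 : J)) (n + 1) hw
  rw [pow_op_E_pow_op_F_toVerma, ← map_nsmul, ← LieSubmodule.Quotient.mk_eq_zero] at h1
  have h2 := hinj (h1.trans (by rw [map_zero, map_zero]) :
    LieSubmodule.Quotient.mk' X (V.toVerma _) = LieSubmodule.Quotient.mk' X (V.toVerma 0))
  rw [← Nat.cast_smul_eq_nsmul k, smul_eq_zero] at h2
  exact h2.resolve_left (Nat.cast_ne_zero.2 (Nat.factorial_ne_zero _))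

lemma hasBoundedQuotient_of_pow_eq_zero [Nontrivial M] {n : ℕ} (hn : V.IsOfLevel n)
    (h : ∀ (a : J) (m : M), (op V.Verma (E k (1 : J)) ^ (n + 1))
      ((op V.Verma (F k a) ^ (n + 1)) (V.toVerma m)) = 0) : V.HasBoundedQuotient n := by
  refine hasBoundedQuotient_of_hom hn V.vermaToCoinduced (fun m m' hm => ?_)
    (vermaToCoinduced_eq_zero h)
  simp only [vermaToCoinduced_toVerma] at hm
  exact Coinduced.const_injective hm

lemma pow_eq_zero_iff (n : ℕ) (a : J) :
    (∀ m : M, (op V.Verma (E k (1 : J)) ^ (n + 1))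
      ((op V.Verma (F k a) ^ (n + 1)) (V.toVerma m)) = 0) ↔
    newtonSum (fun i => V.ρ (jpow a i)) n 1 = 0 := by
  refine ⟨fun h => LinearMap.ext fun m => ?_, fun h m => ?_⟩
  · have h1 := h m
    rw [pow_op_E_pow_op_F_toVerma, ← map_nsmul] at h1
    have h2 := V.toVerma_injective (h1.trans (map_zero _).symm)
    rw [← Nat.cast_smul_eq_nsmul k, smul_eq_zero] at h2
    exact h2.resolve_left (Nat.cast_ne_zero.2 (Nat.factorial_ne_zero _))
  · rw [pow_op_E_pow_op_F_toVerma, h, LinearMap.zero_apply, map_zero, smul_zero]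

end JSpace

end JordanSL2
end

theorem theorem2 {k : Type*} [Field k] [IsAlgClosed k] [CharZero k]
    {J : Type*} [NonAssocCommRing J] [Module k J] [IsScalarTower k J J] [SMulCommClass k J J]
    [IsCommJordan J] {M : Type*} [AddCommGroup M] [Module k M] [Nontrivial M]
    (V : JordanSL2.JSpace k J M) (n : ℕ) (hn : V.IsOfLevel n) :
    List.TFAE [
      V.IsDominant n,
      V.HasBoundedQuotient n,
      ∀ (a : J) (m : M),
        ((UniversalEnvelopingAlgebra.ι k (JordanSL2.SL2J.E k (1 : J))) ^ (n + 1) *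
          (UniversalEnvelopingAlgebra.ι k (JordanSL2.SL2J.F k a)) ^ (n + 1)) • V.toVerma m = 0,
      ∀ a : J, ∑ σ : (n + 1).Partition,
        (JordanSL2.signPartition σ * ((JordanSL2.conjClass σ).card : ℤ)) • V.ρPartition σ a = 0] := by
  simp only [V.sum_conjClass_smul_ρPartition]
  simp only [mul_smul, JordanSL2.JSpace.pow_ι_smul]
  tfae_have 1 → 2 := JordanSL2.JSpace.hasBoundedQuotient_of_isDominant hn
  tfae_have 2 → 1 := JordanSL2.JSpace.isDominant_of_hasBoundedQuotient hn
  tfae_have 2 → 4 := JordanSL2.JSpace.newtonSum_ρ_eq_zero_of_hasBoundedQuotient hn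
  tfae_have 4 ↔ 3 :=
    forall_congr' fun a => (JordanSL2.JSpace.pow_eq_zero_iff n a).symm
  tfae_have 3 → 2 := JordanSL2.JSpace.hasBoundedQuotient_of_pow_eq_zero hn
  tfae_finish
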